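/- Let $\Bbbk$ be a field. For a $\Bbbk$-bialgebra $B$ put $$B\boxslash B=\Bigl\{\sum_i x^i\otimes y_i\in B\otimes B \;\Big|\; \sum_i x^i_1\otimes y_{i\,1}\otimes x^i_2\,y_{i\,2}=\sum_i x^i\otimes y_i\otimes 1\Bigr\},$$ $$p_B\colon B\boxslash B\to B,\quad \sum_i x^i\otimes y_i\mapsto \sum_i x^i\varepsilon(y_i),\qquad K(B)=\{b\in B\mid \Delta(b)\in \mathrm{im}(p_B)\otimes B\}.$$ $K(B)$ is a sub-bialgebra of $B$; let $k_B\colon K(B)\to B$ be the inclusion. Let $\mathsf{Bialg}^{\mathsf{in}}$ be the full subcategory of the category of $\Bbbk$-bialgebras on those $B$ with $p_B$ injective. Then $K$ restricts to an endofunctor of $\mathsf{Bialg}^{\mathsf{in}}$ and $(K,k)$ is well-copointed there, i.e. $K(k_B)=k_{K(B)}$ for all $B$. Let $K^\infty(B)=\bigcap_{n\ge 0}K^n(B)\subseteq B$, where $K^n(B)$ is the $n$-fold iterate, regarded as a sub-bialgebra of $B$, and let $\sigma^0_\infty\colon K^\infty(B)\to B$ be the inclusion. (1) For every $B$ in $\mathsf{Bialg}^{\mathsf{in}}$: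 $K^\infty(B)$ is a sub-bialgebra of $B$ and is the limit in $\mathsf{Bialg}^{\mathsf{in}}$ of the cofree-coalgebra sequence $\cdots\to K^2(B)\xrightarrow{k_{K(B)}}K(B)\xrightarrow{k_B}B$, with $\sigma^0_\infty$ as the component of the limit cone at $B$; the map $p_{K^\infty(B)}$ is bijective; and the natural transformation $kK^\infty\colon KK^\infty\to K^\infty$ is an isomorphism (the sequence converges at $\infty$). (2) A $K$-coalgebra is an object $A$ of $\mathsf{Bialg}^{\mathsf{in}}$ with a morphism $\rho\colon A\to K(A)$ such that $k_A\circ\rho=\mathrm{Id}_A$; a morphism of $K$-coalgebras is a bialgebra map compatible with the coactions. The forgetful functor from $K$-coalgebras to $\mathsf{Bialg}^{\mathsf{in}}$ has a right adjoint, whose value at $B$ has underlying bialgebra $K^\infty(B)$ (naturally in $B$), with counit $\sigma^0_\infty\colon K^\infty(B)\to B$; that is, $K^\infty(B)$ is the cofree $K$-coalgebra on $B$. (3) Right Hopf algebras with a right antipode (a right convolution inverse of the identity) that is an anti-bialgebra map belong to $\mathsf{Bialg}^{\mathsf{in}}$ and form a full mono-coreflective subcategory of it: the inclusion has a right adjoint,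 the coreflection of $B$ is $\sigma^0_\infty\colon K^\infty(B)\to B$, and the components of the counit are monomorphisms. (4) Let $B$ be a bialgebra that either is right perfect (its underlying ring satisfies the descending chain condition on principal left ideals), or is a left $n$-Hopf algebra for some $n\in\mathbb N$ ($n$ is minimal such that there is a linear $S\colon B\to B$ with $S*\mathrm{Id}^{*(n+1)}=\mathrm{Id}^{*n}$ for the convolution product). Then $\mathrm C(B)=K^\infty(B)$: the bialgebra $K^\infty(B)$ is a Hopf algebra and, together with its inclusion into $B$, it is the cofree Hopf algebra on $B$, i.e. every bialgebra map from a Hopf algebra $H$ to $B$ factors through a unique Hopf algebra map $H\to K^\infty(B)$. -/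

import Mathlib

open CategoryTheory TensorProduct

universe u v w

namespace KellyCofree

noncomputable section

section Tensor

variable {k : Type u} [Field k] {M : Type v} [AddCommGroup M] [Module k M]
  {W : Type w} [AddCommGroup W] [Module k W]

/-- `t ∈ U ⊗ W` if and only if all right slices of `t` lie in `U`. -/
theorem mem_range_rTensor_iff (U : Submodule k M) (t : M ⊗[k] W) :
    t ∈ LinearMap.range (U.subtype.rTensor W) ↔
      ∀ φ : W →ₗ[k] k, TensorProduct.rid k M (φ.lTensor M t) ∈ U := by
  constructor
  · rintro ⟨s, rfl⟩ φ
    induction s with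
    | zero => simp
    | add x y hx hy => simpa only [map_add] using U.add_mem hx hy
    | tmul x y => simpa using U.smul_mem _ x.2
  · intro h
    let b := Module.Basis.ofVectorSpace k W
    have key : ∀ s : M ⊗[k] W, ∃ F : Finset (Module.Basis.ofVectorSpaceIndex k W),
        ∀ G, F ⊆ G → s = ∑ i ∈ G, TensorProduct.rid k M ((b.coord i).lTensor M s) ⊗ₜ[k] b i := by
      classical
      intro s
      induction s with
      | zero => exact ⟨∅, fun G _ => by simp⟩
      | add x y hx hy =>
        obtain ⟨F, hF⟩ := hx
        obtain ⟨F', hF'⟩ := hy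
        refine ⟨F ∪ F', fun G hG => ?_⟩
        have h1 := hF G (Finset.union_subset_left hG)
        have h2 := hF' G (Finset.union_subset_right hG)
        conv_lhs => rw [h1, h2]
        simp only [map_add, add_tmul, Finset.sum_add_distrib]
      | tmul x y =>
        refine ⟨(b.repr y).support, fun G hG => ?_⟩
        have hy : y = ∑ i ∈ G, b.repr y i • b i := by
          conv_lhs => rw [← b.linearCombination_repr y, Finsupp.linearCombination_apply]
          exact Finsupp.sum_of_support_subset _ hG _ (by simp)
        conv_lhs => rw [hy]
        simp [tmul_sum, smul_tmul]
    obtain ⟨F, hF⟩ := key t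
    rw [hF F subset_rfl]
    refine Submodule.sum_mem _ fun i _ => ?_
    exact ⟨(⟨_, h (b.coord i)⟩ : U) ⊗ₜ b i, by simp⟩

/-- `t ∈ W ⊗ U` if and only if all left slices of `t` lie in `U`. -/
theorem mem_range_lTensor_iff (U : Submodule k M) (t : W ⊗[k] M) :
    t ∈ LinearMap.range (U.subtype.lTensor W) ↔
      ∀ φ : W →ₗ[k] k, TensorProduct.lid k M (φ.rTensor M t) ∈ U := by
  have h1 : t ∈ LinearMap.range (U.subtype.lTensor W) ↔
      TensorProduct.comm k W M t ∈ LinearMap.range (U.subtype.rTensor W) := by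
    constructor
    · rintro ⟨s, rfl⟩
      exact ⟨TensorProduct.comm k W U s, by
        rw [LinearMap.rTensor, LinearMap.lTensor, TensorProduct.map_comm]⟩
    · rintro ⟨s, hs⟩
      refine ⟨(TensorProduct.comm k W U).symm s, (TensorProduct.comm k W M).injective ?_⟩
      rw [← hs, LinearMap.rTensor, LinearMap.lTensor, ← TensorProduct.map_comm]
      simp
  rw [h1, mem_range_rTensor_iff]
  clear h1
  refine forall_congr' fun φ => ?_
  have : TensorProduct.rid k M (φ.lTensor M (TensorProduct.comm k W M t)) =
      TensorProduct.lid k M (φ.rTensor M t) := by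
    induction t with
    | zero => simp
    | add x y hx hy => simp only [map_add, hx, hy]
    | tmul x y => simp
  rw [this]

/-- Over a field, `(U ⊗ M) ∩ (M ⊗ U) = U ⊗ U` inside `M ⊗ M`. -/
theorem mem_range_map_iff (U : Submodule k M) (t : M ⊗[k] M) :
    t ∈ LinearMap.range (TensorProduct.map U.subtype U.subtype) ↔
      t ∈ LinearMap.range (U.subtype.rTensor M) ∧ t ∈ LinearMap.range (U.subtype.lTensor M) := by
  constructor
  · rintro ⟨s, rfl⟩
    exact ⟨⟨U.subtype.lTensor U s, by
        rw [← LinearMap.comp_apply, LinearMap.rTensor_comp_lTensor]⟩,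
      ⟨U.subtype.rTensor U s, by rw [← LinearMap.comp_apply, LinearMap.lTensor_comp_rTensor]⟩⟩
  · rintro ⟨⟨s, hs⟩, ⟨s', hs'⟩⟩
    obtain ⟨π, hπ⟩ := U.subtype.exists_leftInverse_of_injective (by simp)
    have hπ' : (U.subtype ∘ₗ π) ∘ₗ U.subtype = U.subtype := by
      rw [LinearMap.comp_assoc, hπ, LinearMap.comp_id]
    have e1 : (U.subtype ∘ₗ π).rTensor M t = t := by
      rw [← hs, ← LinearMap.comp_apply, ← LinearMap.rTensor_comp, hπ']
    have e2 : (U.subtype ∘ₗ π).lTensor M t = t := by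
      rw [← hs', ← LinearMap.comp_apply, ← LinearMap.lTensor_comp, hπ']
    refine ⟨TensorProduct.map π π t, ?_⟩
    rw [← LinearMap.comp_apply, ← TensorProduct.map_comp, ← LinearMap.rTensor_comp_lTensor,
      LinearMap.comp_apply, e2, e1]

end Tensor

section Box

variable (k : Type u) [Field k] (B : Type v) [Ring B] [Bialgebra k B]

/-- The right coaction `x ⊗ y ↦ x₁ ⊗ y₁ ⊗ x₂ y₂` of `B` on `B ⊗ B`. -/
def coact : B ⊗[k] B →ₗ[k] (B ⊗[k] B) ⊗[k] B :=
  (LinearMap.mul' k B).lTensor (B ⊗[k] B) ∘ₗ Coalgebra.comul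

/-- `B ⊠ B`: the coinvariants of the diagonal coaction of `B` on `B ⊗ B`, i.e. those `t` with
`coact t = t ⊗ 1`. -/
def boxslash : Submodule k (B ⊗[k] B) :=
  LinearMap.eqLocus (coact k B) ((TensorProduct.mk k (B ⊗[k] B) B).flip 1)

/-- The map `B ⊗ B → B`, `x ⊗ y ↦ x ε(y)`. -/
def idCounit : B ⊗[k] B →ₗ[k] B :=
  (TensorProduct.rid k B).toLinearMap ∘ₗ (Coalgebra.counit (R := k) (A := B)).lTensor B

/-- The canonical map `p_B : B ⊠ B → B`, `x ⊠ y ↦ x ε(y)`. -/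
def pMap : boxslash k B →ₗ[k] B := idCounit k B ∘ₗ (boxslash k B).subtype

variable {k B}

theorem mem_boxslash {t : B ⊗[k] B} : t ∈ boxslash k B ↔ coact k B t = t ⊗ₜ[k] (1 : B) := Iff.rfl

@[simp] theorem idCounit_tmul (x y : B) :
    idCounit k B (x ⊗ₜ y) = Coalgebra.counit (R := k) y • x := by simp [idCounit]

theorem mem_range_pMap {b : B} :
    b ∈ LinearMap.range (pMap k B) ↔ ∃ t ∈ boxslash k B, idCounit k B t = b :=
  ⟨fun ⟨t, ht⟩ => ⟨t.1, t.2, ht⟩, fun ⟨t, ht, h⟩ => ⟨⟨t, ht⟩, h⟩⟩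

/-- The multiplication `(u ⊗ v) (x ⊗ y) = u x ⊗ y v` of `B ⊗ Bᵒᵖ`. -/
def twMul : B ⊗[k] B →ₗ[k] B ⊗[k] B →ₗ[k] B ⊗[k] B :=
  TensorProduct.map₂ (LinearMap.mul k B) (LinearMap.mul k B).flip

theorem twMul_tmul (u v x y : B) :
    twMul (k := k) (u ⊗ₜ v) (x ⊗ₜ y) = (u * x) ⊗ₜ (y * v) := rfl

/-- The map `(p ⊗ q, c) ↦ p c q`. -/
def sandwich : B ⊗[k] B →ₗ[k] B →ₗ[k] B :=
  TensorProduct.lift ((LinearMap.llcomp k B B B).compl₁₂ (LinearMap.mul k B)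
    (LinearMap.mul k B).flip)

theorem sandwich_tmul (p q c : B) : sandwich (k := k) (p ⊗ₜ q) c = p * (c * q) := rfl

theorem coact_twMul (s t : B ⊗[k] B) :
    coact k B (twMul s t) =
      TensorProduct.map₂ (twMul (k := k)) (sandwich (k := k)) (Coalgebra.comul (R := k) s)
        (coact k B t) := by
  induction s with
  | zero => simp
  | add a b ha hb => simp only [map_add, LinearMap.add_apply, ha, hb]
  | tmul u v =>
  induction t with
  | zero => simp
  | add a b ha hb => simp only [map_add, ha, hb]
  | tmul x y =>
  rw [twMul_tmul]
  simp only [coact, LinearMap.comp_apply, TensorProduct.comul_tmul, Bialgebra.comul_mul]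
  generalize Coalgebra.comul (R := k) u = cu
  generalize Coalgebra.comul (R := k) v = cv
  generalize Coalgebra.comul (R := k) x = cx
  generalize Coalgebra.comul (R := k) y = cy
  induction cu with
  | zero => simp
  | add a b ha hb => simp only [map_add, add_mul, add_tmul, LinearMap.add_apply, ha, hb]
  | tmul u₁ u₂ =>
  induction cv with
  | zero => simp
  | add a b ha hb => simp only [map_add, mul_add, tmul_add, LinearMap.add_apply, ha, hb]
  | tmul v₁ v₂ =>
  induction cx with
  | zero => simp
  | add a b ha hb => simp only [map_add, mul_add, add_tmul, ha, hb]
  | tmul x₁ x₂ =>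
  induction cy with
  | zero => simp
  | add a b ha hb => simp only [map_add, add_mul, tmul_add, ha, hb]
  | tmul y₁ y₂ =>
  simp [twMul_tmul, sandwich_tmul, mul_assoc]

theorem twMul_mem {s t : B ⊗[k] B} (hs : s ∈ boxslash k B) (ht : t ∈ boxslash k B) :
    twMul s t ∈ boxslash k B := by
  rw [mem_boxslash] at *
  rw [coact_twMul, ht]
  have : ∀ r : (B ⊗[k] B) ⊗[k] (B ⊗[k] B),
      TensorProduct.map₂ (twMul (k := k)) (sandwich (k := k)) r (t ⊗ₜ (1 : B)) =
      (twMul.flip t).rTensor B ((LinearMap.mul' k B).lTensor (B ⊗[k] B) r) := by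
    intro r
    induction r with
    | zero => simp
    | add a b ha hb => simp only [map_add, LinearMap.add_apply, ha, hb]
    | tmul a b =>
    induction b with
    | zero => simp
    | add b c hb hc => simp only [tmul_add, map_add, LinearMap.add_apply, hb, hc]
    | tmul b c => simp [sandwich_tmul]
  rw [this]
  change (twMul.flip t).rTensor B (coact k B s) = _
  rw [hs]
  simp

theorem idCounit_twMul (s t : B ⊗[k] B) :
    idCounit k B (twMul s t) = idCounit k B s * idCounit k B t := by
  induction s with
  | zero => simp
  | add a b ha hb => simp only [map_add, LinearMap.add_apply, ha, hb, add_mul]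
  | tmul u v =>
  induction t with
  | zero => simp
  | add a b ha hb => simp only [map_add, ha, hb, mul_add]
  | tmul x y => simp [twMul_tmul, smul_smul, mul_comm]

theorem one_mem_boxslash : (1 : B) ⊗ₜ[k] (1 : B) ∈ boxslash k B := by
  rw [mem_boxslash]
  simp [coact, Algebra.TensorProduct.one_def]

theorem slice_comul (φ : B →ₗ[k] k) (x : B) :
    Coalgebra.comul (R := k) (TensorProduct.lid k B (φ.rTensor B (Coalgebra.comul x))) =
      ((TensorProduct.lid k B).toLinearMap ∘ₗ φ.rTensor B ∘ₗ Coalgebra.comul).rTensor B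
        (Coalgebra.comul (R := k) x) := by
  have h1 : ∀ z : B ⊗[k] B,
      Coalgebra.comul (R := k) (TensorProduct.lid k B (φ.rTensor B z)) =
      TensorProduct.lid k (B ⊗[k] B) (φ.rTensor (B ⊗[k] B)
        ((Coalgebra.comul (R := k) (A := B)).lTensor B z)) := by
    intro z
    induction z with
    | zero => simp
    | add a b ha hb => simp only [map_add, ha, hb]
    | tmul a b => simp
  have h2 : ∀ z : B ⊗[k] B,
      ((TensorProduct.lid k B).toLinearMap ∘ₗ φ.rTensor B ∘ₗ Coalgebra.comul).rTensor B z =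
      TensorProduct.lid k (B ⊗[k] B) (φ.rTensor (B ⊗[k] B) (TensorProduct.assoc k B B B
        ((Coalgebra.comul (R := k) (A := B)).rTensor B z))) := by
    intro z
    induction z with
    | zero => simp
    | add a b ha hb => simp only [map_add, ha, hb]
    | tmul a b =>
      simp only [LinearMap.rTensor_tmul, LinearMap.comp_apply]
      generalize Coalgebra.comul (R := k) a = ca
      induction ca with
      | zero => simp
      | add c d hc hd => simp only [map_add, add_tmul, hc, hd]
      | tmul c d => simp [smul_tmul']
  rw [h1, h2, Coalgebra.coassoc_apply]

theorem rTensor_mem_boxslash {L : B →ₗ[k] B}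
    (hL : ∀ x, Coalgebra.comul (R := k) (L x) = L.rTensor B (Coalgebra.comul (R := k) x))
    {t : B ⊗[k] B} (ht : t ∈ boxslash k B) : L.rTensor B t ∈ boxslash k B := by
  rw [mem_boxslash] at *
  have : ∀ s : B ⊗[k] B,
      coact k B (L.rTensor B s) = (L.rTensor B).rTensor B (coact k B s) := by
    intro s
    induction s with
    | zero => simp
    | add a b ha hb => simp only [map_add, ha, hb]
    | tmul x y =>
      simp only [coact, LinearMap.comp_apply, LinearMap.rTensor_tmul, TensorProduct.comul_tmul, hL]
      generalize Coalgebra.comul (R := k) x = cx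
      generalize Coalgebra.comul (R := k) y = cy
      induction cx with
      | zero => simp
      | add a b ha hb => simp only [map_add, add_tmul, ha, hb]
      | tmul x₁ x₂ =>
      induction cy with
      | zero => simp
      | add a b ha hb => simp only [map_add, tmul_add, ha, hb]
      | tmul y₁ y₂ => simp
  rw [this, ht, LinearMap.rTensor_tmul]

/-- The image of `p_B` is a left coideal. -/
theorem comul_mem_of_mem_range_pMap {b : B} (hb : b ∈ LinearMap.range (pMap k B)) :
    Coalgebra.comul b ∈ LinearMap.range ((LinearMap.range (pMap k B)).subtype.lTensor B) := by
  rw [mem_range_lTensor_iff]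
  intro φ
  obtain ⟨t, ht, rfl⟩ := mem_range_pMap.1 hb
  refine mem_range_pMap.2 ⟨_, rTensor_mem_boxslash (L := (TensorProduct.lid k B).toLinearMap ∘ₗ
    φ.rTensor B ∘ₗ Coalgebra.comul) (slice_comul φ) ht, ?_⟩
  clear hb ht
  induction t with
  | zero => simp
  | add a b ha hb => simp only [map_add, ha, hb]
  | tmul x y => simp

theorem map_mem_boxslash {A : Type w} [Ring A] [Bialgebra k A] (f : A →ₐc[k] B)
    {t : A ⊗[k] A} (ht : t ∈ boxslash k A) :
    TensorProduct.map (f : A →ₗ[k] B) (f : A →ₗ[k] B) t ∈ boxslash k B := by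
  rw [mem_boxslash] at *
  have : ∀ s : A ⊗[k] A, coact k B (TensorProduct.map (f : A →ₗ[k] B) (f : A →ₗ[k] B) s) =
      TensorProduct.map (TensorProduct.map (f : A →ₗ[k] B) (f : A →ₗ[k] B)) (f : A →ₗ[k] B)
        (coact k A s) := by
    intro s
    induction s with
    | zero => simp
    | add a b ha hb => simp only [map_add, ha, hb]
    | tmul x y =>
      have hf : ∀ z, Coalgebra.comul (R := k) (f z) =
        TensorProduct.map (f : A →ₗ[k] B) (f : A →ₗ[k] B) (Coalgebra.comul z) :=
        fun z => (CoalgHomClass.map_comp_comul_apply f z).symm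
      simp only [coact, LinearMap.comp_apply, TensorProduct.map_tmul, TensorProduct.comul_tmul]
      rw [show (f : A →ₗ[k] B) x = f x from rfl, show (f : A →ₗ[k] B) y = f y from rfl, hf, hf]
      generalize Coalgebra.comul (R := k) x = cx
      generalize Coalgebra.comul (R := k) y = cy
      induction cx with
      | zero => simp
      | add a b ha hb => simp only [map_add, add_tmul, ha, hb]
      | tmul x₁ x₂ =>
      induction cy with
      | zero => simp
      | add a b ha hb => simp only [map_add, tmul_add, ha, hb]
      | tmul y₁ y₂ => simp
  rw [this, ht]
  simp

theorem idCounit_map {A : Type w} [Ring A] [Bialgebra k A] (f : A →ₐc[k] B) (t : A ⊗[k] A) :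
    idCounit k B (TensorProduct.map (f : A →ₗ[k] B) (f : A →ₗ[k] B) t) = f (idCounit k A t) := by
  induction t with
  | zero => simp
  | add a b ha hb => simp only [map_add, ha, hb]
  | tmul x y => simp

theorem map_mem_range_pMap {A : Type w} [Ring A] [Bialgebra k A] (f : A →ₐc[k] B)
    {a : A} (ha : a ∈ LinearMap.range (pMap k A)) : f a ∈ LinearMap.range (pMap k B) := by
  obtain ⟨t, ht, rfl⟩ := mem_range_pMap.1 ha
  exact mem_range_pMap.2 ⟨_, map_mem_boxslash f ht, idCounit_map f t⟩

/-- A bialgebra that embeds into a bialgebra with injective `p` has injective `p`. -/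
theorem pMap_injective_of_injective {A : Type w} [Ring A] [Bialgebra k A] (f : A →ₐc[k] B)
    (hf : Function.Injective f) (hB : Function.Injective (pMap k B)) :
    Function.Injective (pMap k A) := by
  intro s t hst
  have hinj : Function.Injective (TensorProduct.map (f : A →ₗ[k] B) (f : A →ₗ[k] B)) :=
    TensorProduct.map_injective_of_flat_flat _ _ hf hf
  have : (⟨_, map_mem_boxslash f s.2⟩ : boxslash k B) = ⟨_, map_mem_boxslash f t.2⟩ := by
    apply hB
    exact (idCounit_map f s.1).trans ((congrArg f hst).trans (idCounit_map f t.1).symm)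
  exact Subtype.ext (hinj (congrArg Subtype.val this))

end Box

section SubBialgebra

variable (k : Type u) [Field k] (B : Type v) [Ring B] [Bialgebra k B]

/-- A sub-bialgebra of `B`: a subalgebra `V` with `Δ(V) ⊆ V ⊗ V`. -/
structure SubBialgebra extends Subalgebra k B where
  comul_mem' : ∀ b ∈ toSubalgebra, Coalgebra.comul (R := k) b ∈
    LinearMap.range (TensorProduct.map (Subalgebra.toSubmodule toSubalgebra).subtype
      (Subalgebra.toSubmodule toSubalgebra).subtype)

variable {k B}

namespace SubBialgebra

variable (V : SubBialgebra k B)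

/-- The inclusion as a linear map. -/
def incl : V.toSubalgebra →ₗ[k] B := V.toSubalgebra.val.toLinearMap

theorem incl_apply (x : V.toSubalgebra) : V.incl x = x.1 := rfl

theorem incl_injective : Function.Injective V.incl := Subtype.val_injective

theorem map_incl_injective : Function.Injective (TensorProduct.map V.incl V.incl) :=
  TensorProduct.map_injective_of_flat_flat _ _ V.incl_injective V.incl_injective

/-- The restriction of the comultiplication of `B`. -/
def comul : V.toSubalgebra →ₗ[k] V.toSubalgebra ⊗[k] V.toSubalgebra :=
  (LinearEquiv.ofInjective _ V.map_incl_injective).symm.toLinearMap ∘ₗ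
    (Coalgebra.comul (R := k) (A := B) ∘ₗ V.incl).codRestrict
      (LinearMap.range (TensorProduct.map V.incl V.incl)) fun x => V.comul_mem' x.1 x.2

theorem map_incl_comul (x : V.toSubalgebra) :
    TensorProduct.map V.incl V.incl (V.comul x) = Coalgebra.comul (R := k) (x : B) :=
  LinearEquiv.ofInjective_symm_apply (f := TensorProduct.map V.incl V.incl)
    (h := V.map_incl_injective) ⟨_, _⟩

theorem map_incl_comp_comul :
    TensorProduct.map V.incl V.incl ∘ₗ V.comul = Coalgebra.comul (R := k) ∘ₗ V.incl :=
  LinearMap.ext V.map_incl_comul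

instance instCoalgebra : Coalgebra k V.toSubalgebra where
  comul := V.comul
  counit := Coalgebra.counit (R := k) (A := B) ∘ₗ V.incl
  coassoc := by
    ext x
    have hinj : Function.Injective
        (TensorProduct.map V.incl (TensorProduct.map V.incl V.incl)) :=
      TensorProduct.map_injective_of_flat_flat _ _ V.incl_injective V.map_incl_injective
    apply hinj
    have h1 : ∀ z, TensorProduct.map V.incl (TensorProduct.map V.incl V.incl)
        (TensorProduct.assoc k _ _ _ (V.comul.rTensor _ z)) =
        TensorProduct.assoc k B B B ((Coalgebra.comul (R := k) (A := B)).rTensor B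
          (TensorProduct.map V.incl V.incl z)) := by
      intro z
      rw [TensorProduct.map_map_assoc, LinearMap.rTensor, ← LinearMap.comp_apply,
        ← TensorProduct.map_comp, map_incl_comp_comul, LinearMap.rTensor, ← LinearMap.comp_apply,
        ← TensorProduct.map_comp, LinearMap.id_comp, LinearMap.comp_id]
    have h2 : ∀ z, TensorProduct.map V.incl (TensorProduct.map V.incl V.incl)
        (V.comul.lTensor _ z) =
        (Coalgebra.comul (R := k) (A := B)).lTensor B (TensorProduct.map V.incl V.incl z) := by
      intro z
      rw [LinearMap.lTensor, ← LinearMap.comp_apply,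
        ← TensorProduct.map_comp, map_incl_comp_comul, LinearMap.lTensor, ← LinearMap.comp_apply,
        ← TensorProduct.map_comp, LinearMap.id_comp, LinearMap.comp_id]
    simp only [LinearMap.comp_apply, LinearEquiv.coe_coe]
    rw [h1, h2, map_incl_comul, Coalgebra.coassoc_apply]
  rTensor_counit_comp_comul := by
    ext x
    have hinj : Function.Injective (V.incl.lTensor k) :=
      Module.Flat.lTensor_preserves_injective_linearMap _ V.incl_injective
    apply hinj
    have h1 : ∀ z, V.incl.lTensor k ((Coalgebra.counit (R := k) (A := B) ∘ₗ V.incl).rTensor _ z) =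
        (Coalgebra.counit (R := k) (A := B)).rTensor B (TensorProduct.map V.incl V.incl z) := by
      intro z
      rw [LinearMap.lTensor, LinearMap.rTensor, ← LinearMap.comp_apply, ← TensorProduct.map_comp,
        LinearMap.rTensor, ← LinearMap.comp_apply, ← TensorProduct.map_comp]
      rfl
    simp only [LinearMap.comp_apply]
    rw [h1, map_incl_comul, Coalgebra.rTensor_counit_comul]
    rfl
  lTensor_counit_comp_comul := by
    ext x
    have hinj : Function.Injective (V.incl.rTensor k) :=
      Module.Flat.rTensor_preserves_injective_linearMap _ V.incl_injective
    apply hinj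
    have h1 : ∀ z, V.incl.rTensor k ((Coalgebra.counit (R := k) (A := B) ∘ₗ V.incl).lTensor _ z) =
        (Coalgebra.counit (R := k) (A := B)).lTensor B (TensorProduct.map V.incl V.incl z) := by
      intro z
      rw [LinearMap.lTensor, LinearMap.rTensor, ← LinearMap.comp_apply, ← TensorProduct.map_comp,
        LinearMap.lTensor, ← LinearMap.comp_apply, ← TensorProduct.map_comp]
      rfl
    simp only [LinearMap.comp_apply]
    rw [h1, map_incl_comul, Coalgebra.lTensor_counit_comul]
    rfl

theorem mem_aux (x : V.toSubalgebra ⊗[k] V.toSubalgebra) :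
    TensorProduct.map V.incl V.incl x =
      Algebra.TensorProduct.map V.toSubalgebra.val V.toSubalgebra.val x := rfl

instance instBialgebra : Bialgebra k V.toSubalgebra :=
  Bialgebra.mk' k V.toSubalgebra
    (Bialgebra.counit_one (R := k) (A := B))
    (fun {a b} => Bialgebra.counit_mul (R := k) (a : B) (b : B))
    (V.map_incl_injective <| by
      refine (V.map_incl_comul 1).trans ?_
      rw [mem_aux, map_one]
      exact Bialgebra.comul_one)
    (fun {a b} => V.map_incl_injective <| by
      refine (V.map_incl_comul (a * b)).trans ?_
      rw [mem_aux, map_mul, ← mem_aux, ← mem_aux]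
      refine (Bialgebra.comul_mul (R := k) (a : B) (b : B)).trans ?_
      exact congrArg₂ (· * ·) (V.map_incl_comul a).symm (V.map_incl_comul b).symm)

/-- The inclusion `V → B` as a bialgebra map. -/
def val : V.toSubalgebra →ₐc[k] B :=
  { V.toSubalgebra.val with
    map_smul' := fun _ _ => rfl
    counit_comp := rfl
    map_comp_comul := V.map_incl_comp_comul }

@[simp] theorem val_apply (x : V.toSubalgebra) : V.val x = x.1 := rfl

theorem val_injective : Function.Injective V.val := Subtype.val_injective

/-- Corestriction of a bialgebra map whose image is contained in a sub-bialgebra. -/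
def codRestrict {A : Type w} [Ring A] [Bialgebra k A] (f : A →ₐc[k] B)
    (hf : ∀ a, f a ∈ V.toSubalgebra) : A →ₐc[k] V.toSubalgebra :=
  { (f : A →ₐ[k] B).codRestrict V.toSubalgebra hf with
    map_smul' := ((f : A →ₐ[k] B).codRestrict V.toSubalgebra hf).toLinearMap.map_smul
    counit_comp := CoalgHomClass.counit_comp f
    map_comp_comul := by
      refine LinearMap.ext fun a => V.map_incl_injective ?_
      refine Eq.trans ?_ (V.map_incl_comul _).symm
      rw [LinearMap.comp_apply, ← LinearMap.comp_apply (TensorProduct.map V.incl V.incl),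
        ← TensorProduct.map_comp]
      exact CoalgHomClass.map_comp_comul_apply f a }

@[simp] theorem codRestrict_apply {A : Type w} [Ring A] [Bialgebra k A] (f : A →ₐc[k] B)
    (hf : ∀ a, f a ∈ V.toSubalgebra) (a : A) : (V.codRestrict f hf a : B) = f a := rfl

end SubBialgebra

/-- The image of a bialgebra map is a sub-bialgebra. -/
def range {A : Type w} [Ring A] [Bialgebra k A] (f : A →ₐc[k] B) : SubBialgebra k B where
  toSubalgebra := (f : A →ₐ[k] B).range
  comul_mem' := by
    rintro _ ⟨a, rfl⟩
    refine ⟨TensorProduct.map (f : A →ₐ[k] B).rangeRestrict.toLinearMap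
      (f : A →ₐ[k] B).rangeRestrict.toLinearMap (Coalgebra.comul a), ?_⟩
    rw [← LinearMap.comp_apply, ← TensorProduct.map_comp]
    exact CoalgHomClass.map_comp_comul_apply f a

/-- The intersection of a family of sub-bialgebras is a sub-bialgebra. -/
def iInter {ι : Type w} (V : ι → SubBialgebra k B) : SubBialgebra k B where
  toSubalgebra := ⨅ i, (V i).toSubalgebra
  comul_mem' := by
    intro b hb
    have hV : ∀ i, b ∈ (V i).toSubalgebra := fun i => (iInf_le (fun i => (V i).toSubalgebra) i) hb
    rw [mem_range_map_iff, mem_range_rTensor_iff, mem_range_lTensor_iff]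
    constructor
    · intro φ
      refine Algebra.mem_iInf.2 fun i => ?_
      exact (mem_range_rTensor_iff _ _).1
        ((mem_range_map_iff _ _).1 ((V i).comul_mem' b (hV i))).1 φ
    · intro φ
      refine Algebra.mem_iInf.2 fun i => ?_
      exact (mem_range_lTensor_iff _ _).1
        ((mem_range_map_iff _ _).1 ((V i).comul_mem' b (hV i))).2 φ

end SubBialgebra

section KB

variable (k : Type u) [Field k] (B : Type v) [Ring B] [Bialgebra k B]

/-- `im(p_B) ⊗ B` as a subspace of `B ⊗ B`. -/
def imTensor : Submodule k (B ⊗[k] B) :=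
  LinearMap.range ((LinearMap.range (pMap k B)).subtype.rTensor B)

variable {k B}

theorem one_mem_range_pMap : (1 : B) ∈ LinearMap.range (pMap k B) :=
  mem_range_pMap.2 ⟨_, one_mem_boxslash, by simp⟩

theorem mul_mem_range_pMap {a b : B} (ha : a ∈ LinearMap.range (pMap k B))
    (hb : b ∈ LinearMap.range (pMap k B)) : a * b ∈ LinearMap.range (pMap k B) := by
  obtain ⟨s, hs, rfl⟩ := mem_range_pMap.1 ha
  obtain ⟨t, ht, rfl⟩ := mem_range_pMap.1 hb
  exact mem_range_pMap.2 ⟨_, twMul_mem hs ht, idCounit_twMul s t⟩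

theorem tmul_mem_imTensor {a : B} (ha : a ∈ LinearMap.range (pMap k B)) (b : B) :
    a ⊗ₜ[k] b ∈ imTensor k B := ⟨⟨a, ha⟩ ⊗ₜ b, rfl⟩

theorem one_mem_imTensor : (1 : B ⊗[k] B) ∈ imTensor k B :=
  tmul_mem_imTensor one_mem_range_pMap 1

theorem mul_mem_imTensor {s t : B ⊗[k] B} (hs : s ∈ imTensor k B) (ht : t ∈ imTensor k B) :
    s * t ∈ imTensor k B := by
  obtain ⟨s, rfl⟩ := hs
  obtain ⟨t, rfl⟩ := ht
  induction s with
  | zero => simp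
  | add a b ha hb => simpa only [map_add, add_mul] using add_mem ha hb
  | tmul u v =>
  induction t with
  | zero => simp
  | add a b ha hb => simpa only [map_add, mul_add] using add_mem ha hb
  | tmul x y =>
    simpa using tmul_mem_imTensor (mul_mem_range_pMap u.2 x.2) (v * y)

theorem slice_right_comul (φ : B →ₗ[k] k) (x : B) :
    Coalgebra.comul (R := k) (TensorProduct.rid k B (φ.lTensor B (Coalgebra.comul x))) =
      ((TensorProduct.rid k B).toLinearMap ∘ₗ φ.lTensor B ∘ₗ Coalgebra.comul).lTensor B
        (Coalgebra.comul (R := k) x) := by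
  have h1 : ∀ z : B ⊗[k] B,
      Coalgebra.comul (R := k) (TensorProduct.rid k B (φ.lTensor B z)) =
      TensorProduct.rid k (B ⊗[k] B) (φ.lTensor (B ⊗[k] B)
        ((Coalgebra.comul (R := k) (A := B)).rTensor B z)) := by
    intro z
    induction z with
    | zero => simp
    | add a b ha hb => simp only [map_add, ha, hb]
    | tmul a b => simp
  have h2 : ∀ z : B ⊗[k] B,
      ((TensorProduct.rid k B).toLinearMap ∘ₗ φ.lTensor B ∘ₗ Coalgebra.comul).lTensor B z =
      TensorProduct.rid k (B ⊗[k] B) (φ.lTensor (B ⊗[k] B) ((TensorProduct.assoc k B B B).symm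
        ((Coalgebra.comul (R := k) (A := B)).lTensor B z))) := by
    intro z
    induction z with
    | zero => simp
    | add a b ha hb => simp only [map_add, ha, hb]
    | tmul a b =>
      simp only [LinearMap.lTensor_tmul, LinearMap.comp_apply]
      generalize Coalgebra.comul (R := k) b = cb
      induction cb with
      | zero => simp
      | add c d hc hd => simp only [map_add, tmul_add, hc, hd]
      | tmul c d => simp
  rw [h1, h2, Coalgebra.coassoc_symm_apply]

variable (k B)

/-- `K(B) = {b ∈ B | Δ(b) ∈ im(p_B) ⊗ B}` as a subalgebra. -/
def Kalg : Subalgebra k B where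
  carrier := {b | Coalgebra.comul (R := k) b ∈ imTensor k B}
  mul_mem' := fun {a b} ha hb => by
    rw [Set.mem_ofPred_eq, Bialgebra.comul_mul]
    exact mul_mem_imTensor ha hb
  add_mem' := fun {a b} ha hb => by
    rw [Set.mem_ofPred_eq, map_add]
    exact add_mem ha hb
  algebraMap_mem' := fun r => by
    rw [Set.mem_ofPred_eq, Bialgebra.comul_algebraMap, Algebra.algebraMap_eq_smul_one]
    exact (imTensor k B).smul_mem r one_mem_imTensor

variable {k B}

theorem mem_Kalg {b : B} : b ∈ Kalg k B ↔ Coalgebra.comul (R := k) b ∈ imTensor k B := Iff.rfl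

theorem slice_right_mem_Kalg (φ : B →ₗ[k] k) {b : B} (hb : b ∈ Kalg k B) :
    TensorProduct.rid k B (φ.lTensor B (Coalgebra.comul b)) ∈ Kalg k B := by
  rw [mem_Kalg, slice_right_comul]
  obtain ⟨s, hs⟩ := mem_Kalg.1 hb
  rw [← hs, ← LinearMap.comp_apply, LinearMap.lTensor_comp_rTensor,
    ← LinearMap.rTensor_comp_lTensor, LinearMap.comp_apply]
  exact ⟨_, rfl⟩

theorem slice_left_mem_Kalg (φ : B →ₗ[k] k) {b : B} (hb : b ∈ Kalg k B) :
    TensorProduct.lid k B (φ.rTensor B (Coalgebra.comul b)) ∈ Kalg k B := by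
  rw [mem_Kalg, slice_comul]
  obtain ⟨s, hs⟩ := mem_Kalg.1 hb
  rw [← hs]
  clear hs hb
  induction s with
  | zero => simp
  | add x y hx hy => simpa only [map_add] using add_mem hx hy
  | tmul x y =>
    obtain ⟨x, hx⟩ := x
    have h := comul_mem_of_mem_range_pMap hx
    rw [mem_range_lTensor_iff] at h
    replace h := h φ
    simp only [LinearMap.rTensor_tmul, LinearMap.comp_apply, Submodule.subtype_apply,
      LinearEquiv.coe_coe]
    exact tmul_mem_imTensor h y

variable (k B)

/-- `K(B) = {b ∈ B | Δ(b) ∈ im(p_B) ⊗ B}`, a sub-bialgebra of `B`. -/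
def KB : SubBialgebra k B where
  toSubalgebra := Kalg k B
  comul_mem' := fun b hb => by
    rw [mem_range_map_iff, mem_range_rTensor_iff, mem_range_lTensor_iff]
    exact ⟨fun φ => slice_right_mem_Kalg φ hb, fun φ => slice_left_mem_Kalg φ hb⟩

variable {k B}

theorem map_mem_KB {A : Type w} [Ring A] [Bialgebra k A] (f : A →ₐc[k] B)
    {a : A} (ha : a ∈ (KB k A).toSubalgebra) : f a ∈ (KB k B).toSubalgebra := by
  have ha' : Coalgebra.comul (R := k) a ∈ imTensor k A := ha
  change Coalgebra.comul (R := k) (f a) ∈ imTensor k B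
  rw [← CoalgHomClass.map_comp_comul_apply]
  obtain ⟨s, hs⟩ := ha'
  rw [← hs]
  clear hs ha
  induction s with
  | zero => simp
  | add x y hx hy => simpa only [map_add] using add_mem hx hy
  | tmul x y => exact tmul_mem_imTensor (map_mem_range_pMap f x.2) (f y)

end KB

section CopointedEndofunctors

variable {C : Type u} [Category.{v} C] (F : C ⥤ C) (σ : F ⟶ 𝟭 C)

/-- A copointed endofunctor `(F, σ : F ⟶ 𝟭)` is well-copointed if `F σ = σ F`. -/
def IsWellCopointed : Prop := ∀ X : C, F.map (σ.app X) = σ.app (F.obj X)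

/-- The iterates `Fⁿ`. -/
def iter : ℕ → C ⥤ C
  | 0 => 𝟭 C
  | n + 1 => iter n ⋙ F

/-- The composites `Fⁿ ⟶ ⋯ ⟶ F ⟶ 𝟭` of the connecting maps. -/
def iterTo : ∀ n : ℕ, iter F n ⟶ 𝟭 C
  | 0 => 𝟙 _
  | n + 1 => Functor.whiskerLeft (iter F n) σ ≫ (Functor.rightUnitor _).hom ≫ iterTo n

/-- The cofree-coalgebra sequence `⋯ ⟶ F²X ⟶ FX ⟶ X`, with connecting maps `σ_{FⁿX}`. -/
def cofreeSeq (X : C) : ℕᵒᵖ ⥤ C :=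
  Functor.ofOpSequence (X := fun n => (iter F n).obj X) fun n => σ.app ((iter F n).obj X)

/-- The coalgebras of the copointed endofunctor `(F, σ)`: objects `A` with a coaction
`ρ : A ⟶ F A` such that `ρ ≫ σ_A = 𝟙`. -/
def isCopointedCoalgebra : ObjectProperty (Endofunctor.Coalgebra F) :=
  fun A => A.str ≫ σ.app A.V = 𝟙 A.V

/-- The category `F-Coalg` of coalgebras of the copointed endofunctor `(F, σ)`. -/
abbrev CopointedCoalg := (isCopointedCoalgebra F σ).FullSubcategory

/-- The forgetful functor from `F-Coalg`. -/
def CopointedCoalg.forget : CopointedCoalg F σ ⥤ C :=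
  (isCopointedCoalgebra F σ).ι ⋙ Endofunctor.Coalgebra.forget F

end CopointedEndofunctors

section Functors

variable (k : Type u) [Field k]

/-- The endofunctor `K` of the category of bialgebras. -/
def K : BialgCat.{v} k ⥤ BialgCat.{v} k where
  obj B := BialgCat.of k (KB k B).toSubalgebra
  map {A B} f := BialgCat.ofHom ((KB k B).codRestrict
    (f.toBialgHom.comp (KB k A).val) fun a => map_mem_KB f.toBialgHom a.2)
  map_id _ := rfl
  map_comp _ _ := rfl

/-- The natural inclusion `k_B : K(B) → B`. -/
def kappa : K.{u, v} k ⟶ 𝟭 (BialgCat.{v} k) where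
  app B := BialgCat.ofHom (KB k B).val
  naturality _ _ _ := rfl

/-- `K^∞(B) = ⋂ₙ Kⁿ(B)`, as a sub-bialgebra of `B`; here `Kⁿ(B)` is embedded in `B` by the
composite of the inclusions `Kⁿ(B) → ⋯ → K(B) → B`. -/
def KinfB (B : BialgCat.{v} k) : SubBialgebra k B :=
  iInter fun n : ℕ => range ((iterTo (K k) (kappa k) n).app B).toBialgHom

variable {k}

theorem mem_KinfB {B : BialgCat.{v} k} {b : B} : b ∈ (KinfB k B).toSubalgebra ↔
    ∀ n, ∃ c : (iter (K k) n).obj B,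
      ((iterTo (K k) (kappa k) n).app B).toBialgHom c = b := by
  refine Algebra.mem_iInf.trans (forall_congr' fun n => Iff.rfl)

theorem map_mem_KinfB {A B : BialgCat.{v} k} (f : A ⟶ B) {a : A}
    (ha : a ∈ (KinfB k A).toSubalgebra) : f.toBialgHom a ∈ (KinfB k B).toSubalgebra := by
  rw [mem_KinfB] at *
  intro n
  obtain ⟨c, rfl⟩ := ha n
  refine ⟨((iter (K k) n).map f).toBialgHom c, ?_⟩
  have h := (iterTo (K k) (kappa k) n).naturality f
  exact congrArg (fun g : (iter (K k) n).obj A ⟶ B => g.toBialgHom c) h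

variable (k)

/-- The endofunctor `K^∞` of the category of bialgebras. -/
def Kinf : BialgCat.{v} k ⥤ BialgCat.{v} k where
  obj B := BialgCat.of k (KinfB k B).toSubalgebra
  map {A B} f := BialgCat.ofHom ((KinfB k B).codRestrict
    (f.toBialgHom.comp (KinfB k A).val) fun a => map_mem_KinfB f a.2)
  map_id _ := rfl
  map_comp _ _ := rfl

/-- The natural inclusion `σ⁰_∞ : K^∞(B) → B`. -/
def sigmaInf : Kinf.{u, v} k ⟶ 𝟭 (BialgCat.{v} k) where
  app B := BialgCat.ofHom (KinfB k B).val
  naturality _ _ _ := rfl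

/-- The bialgebras `B` with `p_B` injective. -/
def pInjective : ObjectProperty (BialgCat.{v} k) := fun B => Function.Injective (pMap k B)

/-- The category of bialgebras `B` with `p_B` injective. -/
abbrev BialgIn := (pInjective.{u, v} k).FullSubcategory

/-- The endofunctor `K` of the category of bialgebras with injective `p`. -/
def Kin : BialgIn.{u, v} k ⥤ BialgIn.{u, v} k :=
  (pInjective k).lift ((pInjective k).ι ⋙ K k) fun B =>
    pMap_injective_of_injective (KB k B.obj).val (KB k B.obj).val_injective B.property

/-- The natural inclusion `k : K → 𝟭` on bialgebras with injective `p`. -/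
def kappaIn : Kin.{u, v} k ⟶ 𝟭 (BialgIn.{u, v} k) where
  app B := ObjectProperty.homMk ((kappa k).app B.obj)
  naturality _ _ _ := rfl

/-- The endofunctor `K^∞` of the category of bialgebras with injective `p`. -/
def KinfIn : BialgIn.{u, v} k ⥤ BialgIn.{u, v} k :=
  (pInjective k).lift ((pInjective k).ι ⋙ Kinf k) fun B =>
    pMap_injective_of_injective (KinfB k B.obj).val (KinfB k B.obj).val_injective B.property

/-- The natural inclusion `σ⁰_∞ : K^∞ → 𝟭` on bialgebras with injective `p`. -/
def sigmaInfIn : KinfIn.{u, v} k ⟶ 𝟭 (BialgIn.{u, v} k) where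
  app B := ObjectProperty.homMk ((sigmaInf k).app B.obj)
  naturality _ _ _ := rfl

end Functors

section Hopf

variable (k : Type u) [Field k]

/-- `S` is an anti-bialgebra endomorphism of `B`. -/
structure IsAntiBialgHom {k : Type u} [Field k] {B : Type v} [Ring B] [Bialgebra k B]
    (S : B →ₗ[k] B) : Prop where
  map_one : S 1 = 1
  map_mul : ∀ a b : B, S (a * b) = S b * S a
  counit_map : ∀ a : B, Coalgebra.counit (R := k) (S a) = Coalgebra.counit (R := k) a
  comul_map : ∀ a : B, Coalgebra.comul (R := k) (S a) =
    TensorProduct.map S S (TensorProduct.comm k B B (Coalgebra.comul a))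

/-- `S` is a right antipode: a right convolution inverse of the identity. -/
def IsRightAntipode {k : Type u} [Field k] {B : Type v} [Ring B] [Bialgebra k B]
    (S : B →ₗ[k] B) : Prop :=
  WithConv.toConv (LinearMap.id : B →ₗ[k] B) * WithConv.toConv S = 1

/-- The right Hopf algebras with a right antipode that is an anti-bialgebra map. -/
def isRightHopfAnti : ObjectProperty (BialgCat.{v} k) := fun B =>
  ∃ S : B →ₗ[k] B, IsRightAntipode S ∧ IsAntiBialgHom S

variable (B : Type v) [Ring B] [Bialgebra k B]

/-- `S` satisfies `S * Id^{*(n+1)} = Id^{*n}` for the convolution product. -/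
def IsLeftNAntipode {k : Type u} [Field k] {B : Type v} [Ring B] [Bialgebra k B]
    (n : ℕ) (S : B →ₗ[k] B) : Prop :=
  WithConv.toConv S * WithConv.toConv (LinearMap.id : B →ₗ[k] B) ^ (n + 1) =
    WithConv.toConv (LinearMap.id : B →ₗ[k] B) ^ n

/-- `B` is a left `n`-Hopf algebra: `n` is minimal such that a left `n`-antipode exists. -/
def IsLeftNHopf (n : ℕ) : Prop :=
  IsLeast {m : ℕ | ∃ S : B →ₗ[k] B, IsLeftNAntipode m S} n

/-- A ring is right perfect if it satisfies the descending chain condition on principal left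
ideals. (`Ideal R` is the type of left ideals.) -/
def IsRightPerfect (R : Type v) [Ring R] : Prop :=
  ∀ a : ℕ → R, (∀ n, Ideal.span {a (n + 1)} ≤ Ideal.span {a n}) →
    ∃ N, ∀ n, N ≤ n → Ideal.span {a n} = Ideal.span {a N}

/-- The bialgebra `C`, with the bialgebra map `ε : C → B`, is the cofree Hopf algebra on `B`:
`C` has an antipode, and every bialgebra map from a Hopf algebra `H` to `B` factors uniquely
through `ε`. (Morphisms of Hopf algebras are bialgebra maps; they commute with the antipodes
automatically.) -/
structure IsCofreeHopf {k : Type u} [Field k] {B : Type v} [Ring B] [Bialgebra k B]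
    {C : Type v} [Ring C] [inst : Bialgebra k C] (ε : C →ₐc[k] B) : Prop where
  exists_antipode : ∃ h : HopfAlgebra k C, h.toBialgebra = inst
  existsUnique_lift : ∀ (H : Type w) [Ring H] [HopfAlgebra k H] (f : H →ₐc[k] B),
    ∃! g : H →ₐc[k] C, ε.comp g = f

end Hopf

end

end KellyCofree

/-! The coinvariance relation `x₁ ⊗ y₁ ⊗ x₂y₂ = x ⊗ y ⊗ 1` is a formal version of `t = b₁ ⊗ S(b₂)`.
If `p_B` is bijective, writing `p_B⁻¹(b) = b₁ ⊗ S(b₂)` defines a right antipode that is an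
anti-bialgebra map (`exists_rightAntipode_of_bijective`). Conversely, such an `S` makes `b ↦ b₁ ⊗
S(b₂)` inverse to `p_B`. Hence, inside `Bialg^in`, surjectivity of `p`, invertibility of `k_B`, the
existence of a `K`-coalgebra structure and the existence of an anti-bialgebra right antipode are all
the same condition.

For `b ∈ K^∞(B)`, membership in `K^{n+1}(B)` gives a preimage of `b` under `p` with both legs in
`K^n(B)`. Injectivity of `p_B` makes these preimages equal in `B ⊗ B`, and over a field `⋂ (K^n ⊗
K^n) = K^∞ ⊗ K^∞`; so `p` is bijective on `K^∞(B)` (`pMap_KinfB_bijective`). If `p_A` is surjective,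
then `K` does not shrink `A`, and every map `A → B` lands in `K^∞(B)`. As the inclusions are monic,
factorizations are unique, and both adjunctions follow from one criterion for a fully faithful
functor.

For the last part, right perfect and left `n`-Hopf bialgebras share the property
`IsLocallyLeftNHopf`: locally, every `f * Id^n` has the form `g * Id^{n+1}`. For right perfect `B`
this comes from Björk's theorem, applied to the finitely generated left `B`-submodules `{(f *
Id^m)|_V}` of `Hom(V, B)`, for `V` a finite-dimensional right coideal. The property yields `Σ f(x)y
= g(p(t))` for `t = Σ x ⊗ y` in `B ⊠ B`, so `p_B` is injective; it also turns the right antipode of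
`K^∞(B)` into a two-sided one. A Hopf algebra has surjective `p`, which passes to its image in `B`;
that image therefore lies in `K^∞(B)`. -/

namespace KellyCofree

noncomputable section

/-! ### Iterated Galois maps on coinvariants -/

section Galois

variable {k : Type u} [Field k] {B : Type v} [Ring B] [Bialgebra k B]

/-- A tensor all of whose left slices vanish is zero. -/
theorem ext_rTensor {M N : Type*} [AddCommGroup M] [Module k M] [AddCommGroup N] [Module k N]
    {s t : N ⊗[k] M}
    (h : ∀ φ : N →ₗ[k] k, TensorProduct.lid k M (φ.rTensor M s) =
      TensorProduct.lid k M (φ.rTensor M t)) : s = t := by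
  have hst : s - t ∈ LinearMap.range ((⊥ : Submodule k M).subtype.lTensor N) := by
    rw [mem_range_lTensor_iff]
    intro φ
    rw [Submodule.mem_bot, map_sub, map_sub, h φ, sub_self]
  obtain ⟨r, hr⟩ := hst
  have h0 : (⊥ : Submodule k M).subtype = 0 := by
    ext x
    exact (Submodule.mem_bot k).1 x.2
  rw [h0, LinearMap.lTensor_zero, LinearMap.zero_apply] at hr
  exact sub_eq_zero.1 hr.symm

/-- The map `(x ⊗ y) ⊗ b ↦ (x₁ ⊗ y₁) ⊗ x₂ b y₂`. -/
def sandwichCoact : (B ⊗[k] B) ⊗[k] B →ₗ[k] (B ⊗[k] B) ⊗[k] B :=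
  (TensorProduct.lift (sandwich (k := k) (B := B))).lTensor (B ⊗[k] B) ∘ₗ
    (TensorProduct.assoc k (B ⊗[k] B) (B ⊗[k] B) B).toLinearMap ∘ₗ
      (Coalgebra.comul (R := k) (A := B ⊗[k] B)).rTensor B

/-- The Galois map `x ⊗ b ↦ x₁ ⊗ x₂ b`. -/
def galois : Module.End k (B ⊗[k] B) :=
  (LinearMap.mul' k B).lTensor B ∘ₗ (TensorProduct.assoc k B B B).toLinearMap ∘ₗ
    (Coalgebra.comul (R := k) (A := B)).rTensor B

/-- The map `(x ⊗ y) ⊗ b ↦ x ⊗ b R(y)`. -/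
def mulRight (R : B →ₗ[k] B) : (B ⊗[k] B) ⊗[k] B →ₗ[k] B ⊗[k] B :=
  (LinearMap.mul' k B ∘ₗ (TensorProduct.comm k B B).toLinearMap ∘ₗ R.rTensor B).lTensor B ∘ₗ
    (TensorProduct.assoc k B B B).toLinearMap

/-- The map `y ↦ y₂ R(y₁)`. -/
def opConvId (R : B →ₗ[k] B) : B →ₗ[k] B :=
  LinearMap.mul' k B ∘ₗ (TensorProduct.comm k B B).toLinearMap ∘ₗ R.rTensor B ∘ₗ
    Coalgebra.comul (R := k)

/-- The map `x ⊗ b ↦ f(x) b`. -/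
def evalMul (f : B →ₗ[k] B) : B ⊗[k] B →ₗ[k] B := LinearMap.mul' k B ∘ₗ f.rTensor B

theorem mulRight_tmul_one (R : B →ₗ[k] B) (t : B ⊗[k] B) :
    mulRight R (t ⊗ₜ (1 : B)) = R.lTensor B t := by
  induction t with
  | zero => simp
  | add x y hx hy => simp only [add_tmul, map_add, hx, hy]
  | tmul x y => simp [mulRight]

theorem sandwichCoact_tmul_one (t : B ⊗[k] B) :
    sandwichCoact (k := k) (t ⊗ₜ (1 : B)) = coact k B t := by
  simp only [sandwichCoact, coact, LinearMap.comp_apply, LinearMap.rTensor_tmul,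
    LinearEquiv.coe_coe]
  generalize Coalgebra.comul (R := k) t = c
  induction c with
  | zero => simp
  | add x y hx hy => simp only [add_tmul, map_add, hx, hy]
  | tmul x y =>
    induction y with
    | zero => simp
    | add y z hy hz => simp only [tmul_add, add_tmul, map_add, hy, hz]
    | tmul y z => simp [sandwich_tmul]

/-- Both sides are `x₁ ⊗ x₂ b y₂ R(y₁)`. A coaction step thus trades for a Galois map on the left
leg and one step of `opConvId` on the right leg. -/
theorem mulRight_sandwichCoact (R : B →ₗ[k] B) (z : (B ⊗[k] B) ⊗[k] B) :
    mulRight R (sandwichCoact z) = galois (mulRight (opConvId R) z) := by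
  induction z with
  | zero => simp
  | add x y hx hy => simp only [map_add, hx, hy]
  | tmul t b =>
  induction t with
  | zero => simp
  | add x y hx hy => simp only [add_tmul, map_add, hx, hy]
  | tmul x y =>
  simp only [sandwichCoact, mulRight, galois, opConvId, LinearMap.comp_apply,
    LinearMap.rTensor_tmul, LinearEquiv.coe_coe, TensorProduct.comul_tmul,
    TensorProduct.assoc_tmul, LinearMap.lTensor_tmul, TensorProduct.comm_tmul, LinearMap.mul'_apply]
  generalize Coalgebra.comul (R := k) x = cx
  generalize Coalgebra.comul (R := k) y = cy
  induction cx with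
  | zero => simp
  | add a b ha hb => simp only [map_add, add_tmul, ha, hb]
  | tmul x₁ x₂ =>
  induction cy with
  | zero => simp
  | add a b ha hb => simp only [map_add, add_tmul, tmul_add, mul_add, ha, hb]
  | tmul y₁ y₂ => simp [sandwich_tmul, mul_assoc]

/-- Both sides are `f(x₁) x₂ b`: evaluation turns Galois maps into convolution powers of the
identity. -/
theorem evalMul_galois (f : B →ₗ[k] B) (z : B ⊗[k] B) :
    evalMul f (galois z) =
      evalMul (WithConv.toConv f * WithConv.toConv LinearMap.id).ofConv z := by
  induction z with
  | zero => simp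
  | add x y hx hy => simp only [map_add, hx, hy]
  | tmul x b =>
  simp only [galois, evalMul, LinearMap.comp_apply, LinearMap.rTensor_tmul, LinearEquiv.coe_coe,
    LinearMap.mul'_apply, LinearMap.convMul_apply]
  generalize Coalgebra.comul (R := k) x = cx
  induction cx with
  | zero => simp
  | add a b ha hb => simp only [map_add, add_tmul, add_mul, ha, hb]
  | tmul x₁ x₂ => simp [mul_assoc]

theorem evalMul_galois_pow (f : B →ₗ[k] B) (n : ℕ) (z : B ⊗[k] B) :
    evalMul f ((galois ^ n) z) =
      evalMul (WithConv.toConv f * WithConv.toConv LinearMap.id ^ n).ofConv z := by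
  induction n generalizing f with
  | zero => simp
  | succ n ih =>
    rw [pow_succ', Module.End.mul_apply, evalMul_galois, ih, pow_succ', mul_assoc]

theorem iterate_sandwichCoact {t : B ⊗[k] B} (ht : t ∈ boxslash k B) (n : ℕ) :
    (sandwichCoact (k := k) (B := B))^[n] (t ⊗ₜ (1 : B)) = t ⊗ₜ (1 : B) :=
  Function.iterate_fixed ((sandwichCoact_tmul_one t).trans (mem_boxslash.1 ht)) n

theorem mulRight_iterate (R : B →ₗ[k] B) (n : ℕ) (z : (B ⊗[k] B) ⊗[k] B) :
    mulRight R ((sandwichCoact)^[n] z) = (galois ^ n) (mulRight (opConvId^[n] R) z) := by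
  induction n generalizing R with
  | zero => simp
  | succ n ih =>
    rw [Function.iterate_succ_apply', mulRight_sandwichCoact, ih, pow_succ', Module.End.mul_apply,
      Function.iterate_succ_apply]

/-- On `B ⊠ B` the right leg is recovered from iterated Galois maps. -/
theorem lTensor_eq_galois_pow {t : B ⊗[k] B} (ht : t ∈ boxslash k B) (R : B →ₗ[k] B) (n : ℕ) :
    R.lTensor B t = (galois ^ n) ((opConvId^[n] R).lTensor B t) := by
  rw [← mulRight_tmul_one, ← mulRight_tmul_one, ← mulRight_iterate, iterate_sandwichCoact ht]

/-- The linear map `y ↦ ε(y) 1`. -/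
def unitCounit (k : Type u) [Field k] (B : Type v) [Ring B] [Bialgebra k B] : B →ₗ[k] B :=
  Algebra.linearMap k B ∘ₗ Coalgebra.counit

theorem opConvId_unitCounit : opConvId (unitCounit k B) = LinearMap.id := by
  ext y
  have : ∀ z : B ⊗[k] B, LinearMap.mul' k B (TensorProduct.comm k B B
      ((unitCounit k B).rTensor B z)) =
      TensorProduct.lid k B ((Coalgebra.counit (R := k) (A := B)).rTensor B z) := by
    intro z
    induction z with
    | zero => simp
    | add x y hx hy => simp only [map_add, hx, hy]
    | tmul x y => simp [unitCounit, Algebra.algebraMap_eq_smul_one]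
  simp only [opConvId, LinearMap.comp_apply, LinearEquiv.coe_coe, this,
    Coalgebra.rTensor_counit_comul]
  simp

theorem lTensor_unitCounit (t : B ⊗[k] B) :
    (unitCounit k B).lTensor B t = idCounit k B t ⊗ₜ (1 : B) := by
  induction t with
  | zero => simp
  | add x y hx hy => simp only [map_add, add_tmul, hx, hy]
  | tmul x y => simp [unitCounit, Algebra.algebraMap_eq_smul_one, smul_tmul]

/-- On `B ⊠ B` one has `x y = ε(x) ε(y) 1`. -/
theorem mul'_of_mem_boxslash {t : B ⊗[k] B} (ht : t ∈ boxslash k B) :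
    LinearMap.mul' k B t = algebraMap k B (Coalgebra.counit (R := k) (idCounit k B t)) := by
  -- This reads `p(t) ⊗ 1 = galois t`. Evaluating with the convolution unit turns the right side
  -- into the product `xy`.
  have h := lTensor_eq_galois_pow ht (unitCounit k B) 1
  rw [lTensor_unitCounit, pow_one, Function.iterate_one, opConvId_unitCounit,
    LinearMap.lTensor_id, LinearMap.id_apply] at h
  have h' := congrArg (evalMul (unitCounit k B)) h
  rw [evalMul_galois] at h'
  have h1 : WithConv.toConv (unitCounit k B) = 1 := rfl
  rw [h1, one_mul] at h'
  simpa [evalMul, unitCounit] using h'.symm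

/-- With `Rₙ` the `n`-th iterate of `opConvId` at the identity, `Σ f(x)y = Σ (f * Id^n)(x) Rₙ(y)`
and `g(p(t)) = Σ (g * Id^{n+1})(x) Rₙ(y)`. The hypothesis is needed only on `V`, where the left legs
of `t` lie. -/
theorem evalMul_eq_of_mem_boxslash {f g : B →ₗ[k] B} {n : ℕ} {V : Submodule k B}
    (hfg : ∀ v ∈ V, (WithConv.toConv f * WithConv.toConv LinearMap.id ^ n).ofConv v =
      (WithConv.toConv g * WithConv.toConv LinearMap.id ^ (n + 1)).ofConv v)
    {t : B ⊗[k] B} (ht : t ∈ boxslash k B) (htV : t ∈ LinearMap.range (V.subtype.rTensor B)) :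
    evalMul f t = g (idCounit k B t) := by
  have h1 := lTensor_eq_galois_pow ht LinearMap.id n
  -- One more iteration than in `h1`, started one step earlier at the unit; both therefore end at
  -- the same right-leg map.
  have h2 := lTensor_eq_galois_pow ht (unitCounit k B) (n + 1)
  rw [Function.iterate_succ_apply, opConvId_unitCounit, lTensor_unitCounit] at h2
  rw [LinearMap.lTensor_id, LinearMap.id_apply] at h1
  have h3 : g (idCounit k B t) = evalMul g (idCounit k B t ⊗ₜ (1 : B)) := by simp [evalMul]
  conv_lhs => rw [h1]
  rw [h3, h2, evalMul_galois_pow, evalMul_galois_pow]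
  generalize opConvId^[n] (LinearMap.id : B →ₗ[k] B) = R
  obtain ⟨s, rfl⟩ := htV
  clear h1 h2 h3 ht
  induction s with
  | zero => simp
  | add x y hx hy => simp only [map_add, hx, hy]
  | tmul x y => simp [evalMul, hfg x.1 x.2]

end Galois

/-! ### Björk's theorem on finitely generated submodules -/

section Bjork

variable {R : Type v} [Ring R] {M : Type w} [AddCommGroup M] [Module R M]

/-- Over a right perfect ring, every left module satisfies the descending chain condition on
cyclic submodules. -/
theorem IsRightPerfect.wellFounded_span_singleton (hR : IsRightPerfect R) :
    WellFounded fun x y : M => Submodule.span R {x} < Submodule.span R {y} := by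
  rw [wellFounded_iff_isEmpty_descending_chain]
  refine ⟨fun ⟨a, ha⟩ => ?_⟩
  have h1 : ∀ n, ∃ r : R, r • a n = a (n + 1) := fun n =>
    Submodule.mem_span_singleton.1 ((ha n).le (Submodule.mem_span_singleton_self _))
  choose r hr using h1
  -- The products `r (n-1) ⋯ r 0` generate a descending chain of principal left ideals. Once it
  -- stabilizes, acting on `a 0` contradicts strict descent.
  let p : ℕ → R := fun n => Nat.rec 1 (fun n q => r n * q) n
  have hp : ∀ n, p (n + 1) = r n * p n := fun n => rfl
  have hpa : ∀ n, p n • a 0 = a n := by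
    intro n
    induction n with
    | zero => exact one_smul R _
    | succ n ih => rw [hp, mul_smul, ih, hr]
  obtain ⟨N, hN⟩ := hR p fun n => by
    rw [Ideal.span_singleton_le_iff_mem, Ideal.mem_span_singleton', hp]
    exact ⟨r n, rfl⟩
  have h2 : p N ∈ Ideal.span {p (N + 1)} := by
    rw [hN (N + 1) N.le_succ]
    exact Ideal.mem_span_singleton_self _
  obtain ⟨s, hs⟩ := Ideal.mem_span_singleton'.1 h2
  refine (ha N).not_ge ?_
  rw [Submodule.span_singleton_le_iff_mem, Submodule.mem_span_singleton]
  exact ⟨s, by rw [← hpa (N + 1), ← mul_smul, hs, hpa]⟩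

/-- The descending chain condition on finitely generated submodules of `N`. -/
def FGChainCondition (N : Submodule R M) : Prop :=
  ∀ a : ℕ → Submodule R M, Antitone a → (∀ n, (a n).FG) → a 0 ≤ N → ∃ n, a (n + 1) = a n

/-- The modular law gives `A = Rb + (A ∩ F)`, but `A ∩ F` need not be finitely generated. Instead
each of finitely many generators of `A` is corrected by a multiple of `b`. -/
theorem exists_fg_sup_eq {A F : Submodule R M} {b : M} (hA : A.FG) (hb : b ∈ A)
    (h : A ≤ Submodule.span R {b} ⊔ F) :
    ∃ G : Submodule R M, G.FG ∧ G ≤ F ∧ A = Submodule.span R {b} ⊔ G := by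
  classical
  obtain ⟨s, hs⟩ := hA
  have h1 : ∀ x : s, ∃ f ∈ F, ∃ r : R, r • b + f = x := fun x => by
    obtain ⟨y, hy, f, hf, h'⟩ := Submodule.mem_sup.1
      (h (hs ▸ Submodule.subset_span x.2 : (x : M) ∈ A))
    obtain ⟨r, rfl⟩ := Submodule.mem_span_singleton.1 hy
    exact ⟨f, hf, r, h'⟩
  choose f hf r hr using h1
  refine ⟨Submodule.span R (Set.range f), Submodule.fg_span (Set.finite_range f), ?_, ?_⟩
  · rw [Submodule.span_le]
    rintro _ ⟨x, rfl⟩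
    exact hf x
  · apply le_antisymm
    · rw [← hs, Submodule.span_le]
      intro x hx
      rw [SetLike.mem_coe, show x = _ from (hr ⟨x, hx⟩).symm]
      exact Submodule.add_mem_sup
        (Submodule.smul_mem _ _ (Submodule.mem_span_singleton_self b))
        (Submodule.subset_span ⟨_, rfl⟩)
    · refine sup_le ((Submodule.span_singleton_le_iff_mem _ _).2 hb) ?_
      rw [Submodule.span_le]
      rintro _ ⟨x, rfl⟩
      rw [SetLike.mem_coe, show f x = (x : M) - r x • b by rw [← hr x, add_sub_cancel_left]]
      exact A.sub_mem (hs ▸ Submodule.subset_span x.2) (A.smul_mem _ hb)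

/-- Take `b` in `A` outside `N` with minimal cyclic span: a smaller cyclic submodule with generator
outside `N` would contradict minimality. -/
theorem exists_mem_span_singleton_of_minimal
    (hwf : WellFounded fun x y : M => Submodule.span R {x} < Submodule.span R {y})
    {A N : Submodule R M} (h : ¬A ≤ N) :
    ∃ b ∈ A, b ∉ N ∧ ∀ x ∈ Submodule.span R {b}, x ∉ N → b ∈ Submodule.span R {x} := by
  obtain ⟨x, hx, hx'⟩ := SetLike.not_le_iff_exists.1 h
  let S : Set M := {y | y ∈ A ∧ y ∉ N}
  have hS : S.Nonempty := ⟨x, hx, hx'⟩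
  obtain ⟨h1, h2⟩ := hwf.min_mem S hS
  refine ⟨hwf.min S hS, h1, h2, fun y hy hyN => ?_⟩
  have hle : Submodule.span R {y} ≤ Submodule.span R {hwf.min S hS} :=
    (Submodule.span_singleton_le_iff_mem _ _).2 hy
  have hyA : y ∈ A := (Submodule.span_singleton_le_iff_mem _ _).2 h1 hy
  have := hwf.not_lt_min S (x := y) ⟨hyA, hyN⟩
  by_contra hc
  exact this (lt_of_le_not_ge hle fun h => hc ((Submodule.span_singleton_le_iff_mem _ _).1 h))

/-- Write each term of the chain as `R bᵢ + Fᵢ` with `Fᵢ ≤ N` finitely generated and decreasing. The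
condition on `N` stops the `Fᵢ`, and the minimality of the `bᵢ` makes the cyclic parts
interchangeable. -/
theorem FGChainCondition.sup_span_singleton
    (hwf : WellFounded fun x y : M => Submodule.span R {x} < Submodule.span R {y})
    {N : Submodule R M} (hN : FGChainCondition N) {m : M}
    (hm : ∀ x ∈ Submodule.span R {m}, x ∉ N → m ∈ Submodule.span R {x}) :
    FGChainCondition (N ⊔ Submodule.span R {m}) := by
  intro a ha hfg ha0
  by_cases hc : ∃ i, a i ≤ N
  · obtain ⟨i, hi⟩ := hc
    obtain ⟨n, hn⟩ := hN (fun n => a (i + n)) (fun p q h => ha (Nat.add_le_add_left h i))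
      (fun n => hfg _) hi
    exact ⟨i + n, hn⟩
  push Not at hc
  choose b hbA hbN hb using fun i => exists_mem_span_singleton_of_minimal hwf (hc i)
  -- Exchange argument: `b (i+1) = y + f` with `y ∈ R b i` outside `N`, so `b i` is a multiple of
  -- `y`, hence of `b (i+1)` modulo `F`.
  have key : ∀ i (F : Submodule R M), F ≤ N → a i = Submodule.span R {b i} ⊔ F →
      a i = Submodule.span R {b (i + 1)} ⊔ F := by
    intro i F hF h
    have hmem : b (i + 1) ∈ a i := ha i.le_succ (hbA (i + 1))
    apply le_antisymm
    · have h' := hmem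
      rw [h] at h'
      obtain ⟨y, hy, f, hf, hyf⟩ := Submodule.mem_sup.1 h'
      have hyN : y ∉ N := fun hyN => hbN (i + 1) (hyf ▸ N.add_mem hyN (hF hf))
      obtain ⟨s, hs⟩ := Submodule.mem_span_singleton.1 (hb i y hy hyN)
      rw [h]
      refine sup_le ((Submodule.span_singleton_le_iff_mem _ _).2 ?_) le_sup_right
      have e : b i = s • b (i + 1) + -(s • f) := by
        rw [← hyf, smul_add, hs, add_neg_cancel_right]
      rw [e]
      exact Submodule.add_mem_sup
        (Submodule.smul_mem _ _ (Submodule.mem_span_singleton_self _))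
        (F.neg_mem (F.smul_mem _ hf))
    · exact sup_le ((Submodule.span_singleton_le_iff_mem _ _).2 hmem) (h ▸ le_sup_right)
  have hstart : a 0 ≤ Submodule.span R {b 0} ⊔ N := by
    refine ha0.trans (sup_le le_sup_right ((Submodule.span_singleton_le_iff_mem _ _).2 ?_))
    obtain ⟨n, hn, y, hy, hyn⟩ := Submodule.mem_sup.1 (ha0 (hbA 0))
    have hyN : y ∉ N := fun hyN => hbN 0 (hyn ▸ N.add_mem hn hyN)
    obtain ⟨s, hs⟩ := Submodule.mem_span_singleton.1 (hm y hy hyN)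
    have e : m = s • b 0 + -(s • n) := by
      rw [← hyn, smul_add, hs, add_comm (s • n), add_neg_cancel_right]
    rw [e]
    exact Submodule.add_mem_sup
      (Submodule.smul_mem _ _ (Submodule.mem_span_singleton_self _))
      (N.neg_mem (N.smul_mem _ hn))
  obtain ⟨F₀, hF₀, hF₀N, haF₀⟩ := exists_fg_sup_eq (hfg 0) (hbA 0) hstart
  have step : ∀ i (F : {F : Submodule R M // F.FG ∧ F ≤ N ∧ a i = Submodule.span R {b i} ⊔ F}),
      ∃ G : {G : Submodule R M // G.FG ∧ G ≤ N ∧ a (i + 1) = Submodule.span R {b (i + 1)} ⊔ G},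
        G.1 ≤ F.1 := by
    rintro i ⟨F, hF, hFN, haF⟩
    obtain ⟨G, hG, hGF, haG⟩ := exists_fg_sup_eq (F := F) (hfg (i + 1)) (hbA (i + 1))
      ((ha i.le_succ).trans (key i F hFN haF).le)
    exact ⟨⟨G, hG, hGF.trans hFN, haG⟩, hGF⟩
  choose g hg using step
  let F : ∀ i, {F : Submodule R M // F.FG ∧ F ≤ N ∧ a i = Submodule.span R {b i} ⊔ F} :=
    fun i => Nat.rec ⟨F₀, hF₀, hF₀N, haF₀⟩ (fun i G => g i G) i
  obtain ⟨n, hn⟩ := hN (fun i => (F i).1) (antitone_nat_of_succ_le fun i => hg i (F i))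
    (fun i => (F i).2.1) (F 0).2.2.1
  refine ⟨n, ?_⟩
  -- After the exchange both terms have the cyclic part `R b (n+1)` and differ only in `F n` versus
  -- `F (n+1)`.
  rw [key n _ (F n).2.2.1 (F n).2.2.2, (F (n + 1)).2.2.2]
  exact congrArg _ hn

/-- Björk's theorem: the descending chain condition on cyclic submodules implies the descending
chain condition on finitely generated submodules. -/
theorem fgChainCondition_top
    (hwf : WellFounded fun x y : M => Submodule.span R {x} < Submodule.span R {y}) :
    FGChainCondition (⊤ : Submodule R M) := by
  have hz : ∃ N : Submodule R M, Maximal (· ∈ {N | FGChainCondition N}) N := by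
    apply zorn_le₀
    intro c hc hchain
    rcases c.eq_empty_or_nonempty with rfl | hne
    · refine ⟨⊥, fun a ha _ h0 => ⟨0, ?_⟩, by simp⟩
      have h1 : ∀ n, a n = ⊥ := fun n => le_bot_iff.1 ((ha n.zero_le).trans h0)
      rw [h1, h1]
    · refine ⟨sSup c, fun a ha hfg h0 => ?_, fun z hz => le_sSup hz⟩
      -- The first term is finitely generated, hence compact, so it already lies in one member of
      -- the Zorn chain.
      obtain ⟨N, hNc, hN⟩ := (CompleteLattice.isCompactElement_iff_le_of_directed_sSup_le _ _).1
        ((Submodule.fg_iff_compact _).1 (hfg 0)) c hne hchain.directedOn h0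
      exact hc hNc a ha hfg hN
  obtain ⟨N, hN, hmax⟩ := hz
  by_cases hT : (⊤ : Submodule R M) ≤ N
  · rwa [top_le_iff.1 hT] at hN
  · obtain ⟨m, -, hmN, hm⟩ := exists_mem_span_singleton_of_minimal hwf hT
    exact absurd (hmax (hN.sup_span_singleton hwf hm) le_sup_left
      (le_sup_right (a := N) (Submodule.mem_span_singleton_self m))) hmN

end Bjork

/-! ### The local left n-Hopf condition -/

section LocallyNHopf

variable {k : Type u} [Field k] {B : Type v} [Ring B] [Bialgebra k B]

/-- `V` is a right coideal of `B`: `Δ(V) ⊆ V ⊗ B`. -/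
def IsRightCoideal (V : Submodule k B) : Prop :=
  ∀ v ∈ V, Coalgebra.comul (R := k) v ∈ LinearMap.range (V.subtype.rTensor B)

variable (k B) in
/-- Every finite-dimensional subspace of `B` is contained in a right coideal `V` on which every
linear map `f` satisfies `f * Id^{*n} = g * Id^{*(n+1)}` for some `g`, with `n` depending on `V`
only. -/
def IsLocallyLeftNHopf : Prop :=
  ∀ W : Submodule k B, W.FG → ∃ V : Submodule k B, W ≤ V ∧ IsRightCoideal V ∧
    ∃ n : ℕ, ∀ f : B →ₗ[k] B, ∃ g : B →ₗ[k] B, ∀ v ∈ V,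
      (WithConv.toConv f * WithConv.toConv LinearMap.id ^ n).ofConv v =
        (WithConv.toConv g * WithConv.toConv LinearMap.id ^ (n + 1)).ofConv v

/-- Here `V = B` and `g = f * S`. Minimality of `n` plays no role. -/
theorem IsLeftNAntipode.isLocallyLeftNHopf {n : ℕ} {S : B →ₗ[k] B} (hS : IsLeftNAntipode n S) :
    IsLocallyLeftNHopf k B := fun W _ => by
  refine ⟨⊤, le_top, fun v _ => ?_, n, fun f =>
    ⟨(WithConv.toConv f * WithConv.toConv S).ofConv, fun v _ => ?_⟩⟩
  · exact (mem_range_rTensor_iff _ _).2 fun φ => Submodule.mem_top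
  · rw [WithConv.toConv_ofConv, mul_assoc, hS]

theorem exists_fg_mem_range_rTensor {M N : Type*} [AddCommGroup M] [Module k M] [AddCommGroup N]
    [Module k N] (t : M ⊗[k] N) :
    ∃ W : Submodule k M, W.FG ∧ t ∈ LinearMap.range (W.subtype.rTensor N) := by
  obtain ⟨W, hW, h⟩ := TensorProduct.exists_finite_submodule_left_of_setFinite {t}
    (Set.finite_singleton t)
  exact ⟨W, Module.Finite.iff_fg.1 hW, h rfl⟩

theorem range_rTensor_mono {M N : Type*} [AddCommGroup M] [Module k M] [AddCommGroup N]
    [Module k N] {U W : Submodule k M} (h : U ≤ W) :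
    LinearMap.range (U.subtype.rTensor N) ≤ LinearMap.range (W.subtype.rTensor N) := by
  rintro _ ⟨s, rfl⟩
  refine ⟨(Submodule.inclusion h).rTensor N s, ?_⟩
  rw [← LinearMap.comp_apply, ← LinearMap.rTensor_comp, Submodule.subtype_comp_inclusion]

/-- If every linear map is locally a multiple of `Id` for convolution, then `p` is injective. -/
theorem IsLocallyLeftNHopf.pMap_injective (h : IsLocallyLeftNHopf k B) :
    Function.Injective (pMap k B) := by
  rw [← LinearMap.ker_eq_bot, LinearMap.ker_eq_bot']
  rintro ⟨t, ht⟩ hpt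
  have hpt' : idCounit k B t = 0 := hpt
  obtain ⟨W, hW, htW⟩ := exists_fg_mem_range_rTensor t
  obtain ⟨V, hWV, -, n, hV⟩ := h W hW
  have htV := range_rTensor_mono hWV htW
  refine Subtype.ext (ext_rTensor fun φ => ?_)
  -- For `f = φ(·)1` the sum `Σ f(x)y` is the left slice of `t` at `φ`, and it equals `g(p(t)) = 0`.
  obtain ⟨g, hg⟩ := hV (Algebra.linearMap k B ∘ₗ φ)
  have h1 := evalMul_eq_of_mem_boxslash hg ht htV
  rw [hpt', map_zero] at h1
  have h2 : ∀ s : B ⊗[k] B, evalMul (Algebra.linearMap k B ∘ₗ φ) s =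
      TensorProduct.lid k B (φ.rTensor B s) := by
    intro s
    induction s with
    | zero => simp
    | add x y hx hy => simp only [map_add, hx, hy]
    | tmul x y => simp [evalMul, Algebra.algebraMap_eq_smul_one]
  rw [← h2, h1]
  simp

/-- Only the first legs of `Δ(a)` reach the left factor. This is why right coideals appear:
identities valid on one may be multiplied on the right by convolution. -/
theorem conv_congr {C : Type w} [AddCommGroup C] [Module k C] [Coalgebra k C] {U : Submodule k C}
    {f g : WithConv (C →ₗ[k] B)} (hfg : ∀ u ∈ U, f u = g u) (h : WithConv (C →ₗ[k] B)) {a : C}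
    (ha : Coalgebra.comul (R := k) a ∈ LinearMap.range (U.subtype.rTensor C)) :
    (f * h) a = (g * h) a := by
  rw [LinearMap.convMul_apply, LinearMap.convMul_apply]
  obtain ⟨s, hs⟩ := ha
  rw [← hs]
  clear hs
  induction s with
  | zero => simp
  | add x y hx hy => simp only [map_add, hx, hy]
  | tmul x y => simp [hfg x.1 x.2]

theorem IsRightCoideal.comap {A : Type w} [Ring A] [Bialgebra k A] {ι : A →ₐc[k] B}
    (hι : Function.Injective ι) {V : Submodule k B} (hV : IsRightCoideal V) {a : A}
    (ha : ι a ∈ V) : Coalgebra.comul (R := k) a ∈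
      LinearMap.range ((V.comap (ι : A →ₗ[k] B)).subtype.rTensor A) := by
  rw [mem_range_rTensor_iff]
  intro φ
  -- A linear retraction extends the functional `φ` on `A` to `φ ∘ π` on `B`, where the coideal
  -- condition can be tested.
  obtain ⟨π, hπ⟩ := (ι : A →ₗ[k] B).exists_leftInverse_of_injective (LinearMap.ker_eq_bot.2 hι)
  have h1 := (mem_range_rTensor_iff _ _).1 (hV _ ha) (φ ∘ₗ π)
  rw [← CoalgHomClass.map_comp_comul_apply] at h1
  rw [Submodule.mem_comap]
  convert h1 using 1
  generalize Coalgebra.comul (R := k) a = c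
  induction c with
  | zero => simp
  | add x y hx hy => simp only [map_add, hx, hy]
  | tmul x y =>
    have : π (ι y) = y := LinearMap.congr_fun hπ y
    simp [this]

theorem conv_comp_bialgHom {A : Type w} [Ring A] [Bialgebra k A] (ι : A →ₐc[k] B)
    (f g : WithConv (B →ₗ[k] B)) :
    WithConv.toConv ((f * g).ofConv ∘ₗ (ι : A →ₗ[k] B)) =
      WithConv.toConv (f.ofConv ∘ₗ (ι : A →ₗ[k] B)) *
        WithConv.toConv (g.ofConv ∘ₗ (ι : A →ₗ[k] B)) :=
  congrArg WithConv.toConv (LinearMap.convMul_comp_coalgHom_distrib f g (ι : A →ₗc[k] B))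

theorem conv_pow_comp_bialgHom {A : Type w} [Ring A] [Bialgebra k A] (ι : A →ₐc[k] B)
    (f : WithConv (B →ₗ[k] B)) (n : ℕ) :
    WithConv.toConv ((f ^ n).ofConv ∘ₗ (ι : A →ₗ[k] B)) =
      WithConv.toConv (f.ofConv ∘ₗ (ι : A →ₗ[k] B)) ^ n := by
  induction n with
  | zero =>
    rw [pow_zero, pow_zero]
    refine WithConv.ofConv_injective (LinearMap.ext fun a => ?_)
    exact congrArg (algebraMap k B) (CoalgHomClass.counit_comp_apply ι a)
  | succ n ih => rw [pow_succ, conv_comp_bialgHom, ih, pow_succ]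

/-- A right antipode of a sub-bialgebra of a locally left `n`-Hopf bialgebra is an antipode. -/
theorem IsLocallyLeftNHopf.leftAntipode (h : IsLocallyLeftNHopf k B) {A : Type w} [Ring A]
    [Bialgebra k A] {ι : A →ₐc[k] B} (hι : Function.Injective ι) {S : A →ₗ[k] A}
    (hS : IsRightAntipode S) :
    WithConv.toConv S * WithConv.toConv (LinearMap.id : A →ₗ[k] A) = 1 := by
  let j : WithConv (A →ₗ[k] B) := WithConv.toConv (ι : A →ₗ[k] B)
  let j' : WithConv (A →ₗ[k] B) := WithConv.toConv ((ι : A →ₗ[k] B) ∘ₗ S)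
  have hj : ∀ f g : WithConv (A →ₗ[k] A), WithConv.toConv ((ι : A →ₗ[k] B) ∘ₗ (f * g).ofConv) =
      WithConv.toConv ((ι : A →ₗ[k] B) ∘ₗ f.ofConv) *
        WithConv.toConv ((ι : A →ₗ[k] B) ∘ₗ g.ofConv) := fun f g =>
    congrArg WithConv.toConv (LinearMap.algHom_comp_convMul_distrib (ι : A →ₐ[k] B) f g)
  have hj1 : WithConv.toConv ((ι : A →ₗ[k] B) ∘ₗ (1 : WithConv (A →ₗ[k] A)).ofConv) = 1 := by
    refine WithConv.ofConv_injective (LinearMap.ext fun a => ?_)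
    exact AlgHomClass.commutes ι _
  have hjj' : j * j' = 1 := by
    rw [← hj1, ← hS, hj]
    rfl
  refine WithConv.ofConv_injective (LinearMap.ext fun a => hι ?_)
  obtain ⟨V, hWV, hV, n, hn⟩ := h (Submodule.span k {ι a}) (Submodule.fg_span_singleton _)
  have haV : ι a ∈ V := hWV (Submodule.mem_span_singleton_self _)
  -- Taking `f` to be the convolution unit gives `Id^n = g * Id^{n+1}` on `V`.
  obtain ⟨g, hg⟩ := hn (1 : WithConv (B →ₗ[k] B)).ofConv
  simp only [WithConv.toConv_ofConv, one_mul] at hg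
  let U := V.comap (ι : A →ₗ[k] B)
  have hU : ∀ a ∈ U, Coalgebra.comul (R := k) a ∈ LinearMap.range (U.subtype.rTensor A) :=
    fun a ha => hV.comap hι ha
  let gι : WithConv (A →ₗ[k] B) := WithConv.toConv (g ∘ₗ (ι : A →ₗ[k] B))
  have e1 : ∀ a ∈ U, (gι * j ^ (n + 1)) a = (j ^ n) a := by
    intro a ha
    have h1 := conv_comp_bialgHom ι (WithConv.toConv g) (WithConv.toConv LinearMap.id ^ (n + 1))
    rw [conv_pow_comp_bialgHom] at h1
    have h2 := conv_pow_comp_bialgHom ι (WithConv.toConv (LinearMap.id : B →ₗ[k] B)) n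
    change (WithConv.toConv (_ ∘ₗ _)) = gι * j ^ (n + 1) at h1
    change (WithConv.toConv (_ ∘ₗ _)) = j ^ n at h2
    rw [← h1, ← h2]
    exact (hg _ ha).symm
  have hpow : ∀ m : ℕ, j ^ m * j' ^ m = 1 := by
    intro m
    induction m with
    | zero => simp
    | succ m ih => rw [pow_succ, pow_succ', mul_assoc, ← mul_assoc j, hjj', one_mul, ih]
  have e2 : ∀ a ∈ U, (gι * j) a = (1 : WithConv (A →ₗ[k] B)) a := by
    intro a ha
    have h1 := conv_congr e1 (j' ^ n) (hU a ha)
    rwa [pow_succ', mul_assoc, mul_assoc j, hpow, mul_one] at h1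
  have e3 : ∀ a ∈ U, gι a = j' a := by
    intro a ha
    have h1 := conv_congr e2 j' (hU a ha)
    rwa [mul_assoc, hjj', mul_one, one_mul] at h1
  have e4 : (j' * j) a = (1 : WithConv (A →ₗ[k] B)) a :=
    (conv_congr e3 j (hU a haV)).symm.trans (e2 a haV)
  have e5 := hj (WithConv.toConv S) (WithConv.toConv LinearMap.id)
  change _ = j' * j at e5
  rw [← e5, ← hj1] at e4
  exact e4

/-- A finite-dimensional subspace of a bialgebra lies in a finite-dimensional right coideal. -/
theorem exists_fg_isRightCoideal (W : Submodule k B) (hW : W.FG) :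
    ∃ V : Submodule k B, W ≤ V ∧ V.FG ∧ IsRightCoideal V := by
  induction W, hW using Submodule.fg_induction with
  | singleton x =>
    -- The right slices of `Δ(x)` form the coideal: `ε` gives `x` itself, finiteness holds because
    -- `Δ(x)` is a finite sum, and stability is coassociativity.
    let L : (B →ₗ[k] k) →ₗ[k] B :=
      { toFun := fun φ => TensorProduct.rid k B (φ.lTensor B (Coalgebra.comul x))
        map_add' := fun φ ψ => by simp [LinearMap.lTensor_add]
        map_smul' := fun c φ => by simp [LinearMap.lTensor_smul] }
    refine ⟨LinearMap.range L, ?_, ?_, ?_⟩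
    · rw [Submodule.span_singleton_le_iff_mem]
      exact ⟨Coalgebra.counit, by simp [L]⟩
    · obtain ⟨V₀, hV₀, h⟩ := exists_fg_mem_range_rTensor (Coalgebra.comul (R := k) x)
      refine hV₀.of_le ?_
      rintro _ ⟨φ, rfl⟩
      exact (mem_range_rTensor_iff _ _).1 h φ
    · rintro _ ⟨φ, rfl⟩
      rw [mem_range_rTensor_iff]
      intro ψ
      refine ⟨ψ ∘ₗ (TensorProduct.rid k B).toLinearMap ∘ₗ φ.lTensor B ∘ₗ Coalgebra.comul, ?_⟩
      change _ = TensorProduct.rid k B (ψ.lTensor B (Coalgebra.comul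
        (TensorProduct.rid k B (φ.lTensor B (Coalgebra.comul x)))))
      rw [slice_right_comul, ← LinearMap.comp_apply (ψ.lTensor B), ← LinearMap.lTensor_comp]
      rfl
  | sup M N _ _ ihM ihN =>
    obtain ⟨V, hMV, hV, hV'⟩ := ihM
    obtain ⟨V₂, hNV₂, hV₂, hV₂'⟩ := ihN
    refine ⟨V ⊔ V₂, sup_le_sup hMV hNV₂, hV.sup hV₂, fun x hx => ?_⟩
    obtain ⟨y, hy, z, hz, rfl⟩ := Submodule.mem_sup.1 hx
    rw [map_add]
    exact add_mem (range_rTensor_mono le_sup_left (hV' y hy))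
      (range_rTensor_mono le_sup_right (hV₂' z hz))

/-- A right perfect bialgebra is locally left `n`-Hopf. -/
theorem IsRightPerfect.isLocallyLeftNHopf (hB : IsRightPerfect B) : IsLocallyLeftNHopf k B := by
  intro W hW
  obtain ⟨V, hWV, hVfg, hV⟩ := exists_fg_isRightCoideal W hW
  refine ⟨V, hWV, hV, ?_⟩
  -- `f ↦ (f * Id^m)|_V` is linear for left multiplication by `B` on values. Its ranges form the
  -- chain to which Björk's theorem applies.
  let T : ℕ → (B →ₗ[k] B) →ₗ[B] (V →ₗ[k] B) := fun m =>
    { toFun := fun f =>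
        (WithConv.toConv f * WithConv.toConv LinearMap.id ^ m).ofConv ∘ₗ V.subtype
      map_add' := fun f g => by rw [WithConv.toConv_add, add_mul]; rfl
      map_smul' := fun b f => by rw [WithConv.toConv_smul, smul_mul_assoc]; rfl }
  have hT : ∀ m (f g : B →ₗ[k] B), (∀ v ∈ V, f v = g v) → T m f = T m g := fun m f g hfg =>
    LinearMap.ext fun v => conv_congr hfg _ (hV v.1 v.2)
  have : Module.Finite k V := Module.Finite.iff_fg.2 hVfg
  let b := Module.finBasis k V
  -- The dual basis of `V`, with values in `k·1` and extended to `B`, generates all restrictions to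
  -- `V` over `B`. By `hT` its images generate the range of each `T m`.
  choose lam hlam using fun i => LinearMap.exists_extend (Algebra.linearMap k B ∘ₗ b.coord i)
  have hspan : ∀ f : B →ₗ[k] B, ∀ v ∈ V, f v = (∑ i, f (b i) • lam i) v := by
    intro f v hv
    have h1 : ∀ i, lam i v = algebraMap k B (b.repr ⟨v, hv⟩ i) := fun i =>
      LinearMap.congr_fun (hlam i) ⟨v, hv⟩
    have h2 := congrArg (fun x : V => f x) (b.sum_repr ⟨v, hv⟩)
    simp only [Submodule.coe_sum, map_sum, Submodule.coe_smul, map_smul] at h2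
    rw [← h2]
    simp [h1, Algebra.algebraMap_eq_smul_one]
  have hfg : ∀ m, (LinearMap.range (T m)).FG := by
    intro m
    have : LinearMap.range (T m) = Submodule.span B (Set.range fun i => T m (lam i)) := by
      apply le_antisymm
      · rintro _ ⟨f, rfl⟩
        rw [hT m f _ (hspan f), map_sum]
        refine Submodule.sum_mem _ fun i _ => ?_
        rw [map_smul]
        exact Submodule.smul_mem _ _ (Submodule.subset_span ⟨i, rfl⟩)
      · rw [Submodule.span_le]
        rintro _ ⟨i, rfl⟩
        exact ⟨_, rfl⟩
    rw [this]
    exact Submodule.fg_span (Set.finite_range _)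
  have hanti : Antitone fun m => LinearMap.range (T m) := antitone_nat_of_succ_le fun m => by
    rintro _ ⟨f, rfl⟩
    refine ⟨(WithConv.toConv f * WithConv.toConv LinearMap.id).ofConv, ?_⟩
    change (WithConv.ofConv _) ∘ₗ _ = (WithConv.ofConv _) ∘ₗ _
    rw [WithConv.toConv_ofConv, mul_assoc, ← pow_succ']
  obtain ⟨n, hn⟩ := fgChainCondition_top hB.wellFounded_span_singleton
    (fun m => LinearMap.range (T m)) hanti hfg le_top
  refine ⟨n, fun f => ?_⟩
  have hf : T n f ∈ LinearMap.range (T (n + 1)) := by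
    rw [show LinearMap.range (T (n + 1)) = LinearMap.range (T n) from hn]
    exact ⟨f, rfl⟩
  obtain ⟨g, hg⟩ := hf
  exact ⟨g, fun v hv => (LinearMap.congr_fun hg ⟨v, hv⟩).symm⟩

end LocallyNHopf

/-! ### Bijectivity of p and right antipodes -/

section Antipode

variable {k : Type u} [Field k] {B : Type v} [Ring B] [Bialgebra k B]

theorem conv_algHom_comp {C : Type*} [AddCommGroup C] [Module k C] [Coalgebra k C] {A D : Type*}
    [Ring A] [Algebra k A] [Ring D] [Algebra k D] (h : A →ₐ[k] D) (f g : WithConv (C →ₗ[k] A)) :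
    WithConv.toConv (h.toLinearMap ∘ₗ (f * g).ofConv) =
      WithConv.toConv (h.toLinearMap ∘ₗ f.ofConv) * WithConv.toConv (h.toLinearMap ∘ₗ g.ofConv) :=
  congrArg WithConv.toConv (LinearMap.algHom_comp_convMul_distrib h f g)

theorem conv_algHom_comp_one {C : Type*} [AddCommGroup C] [Module k C] [Coalgebra k C]
    {A D : Type*} [Ring A] [Algebra k A] [Ring D] [Algebra k D] (h : A →ₐ[k] D) :
    WithConv.toConv (h.toLinearMap ∘ₗ (1 : WithConv (C →ₗ[k] A)).ofConv) = 1 :=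
  WithConv.ofConv_injective (LinearMap.ext fun c => by simp)

/-- The condition `(1 ⊗ b₁) Δ(S(b₂)) = S(b) ⊗ 1`. -/
def IsCoinvariantMap (S : B →ₗ[k] B) : Prop :=
  WithConv.toConv (Algebra.TensorProduct.includeRight : B →ₐ[k] B ⊗[k] B).toLinearMap *
      WithConv.toConv (Coalgebra.comul (R := k) ∘ₗ S) =
    WithConv.toConv ((Algebra.TensorProduct.includeLeft : B →ₐ[k] B ⊗[k] B).toLinearMap ∘ₗ S)

theorem coact_tmul (x y : B) : coact k B (x ⊗ₜ y) =
    Algebra.TensorProduct.map (Algebra.TensorProduct.includeLeft : B →ₐ[k] B ⊗[k] B)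
      (AlgHom.id k B) (Coalgebra.comul (R := k) x) *
    Algebra.TensorProduct.map (Algebra.TensorProduct.includeRight : B →ₐ[k] B ⊗[k] B)
      (AlgHom.id k B) (Coalgebra.comul (R := k) y) := by
  simp only [coact, LinearMap.comp_apply, TensorProduct.comul_tmul]
  generalize Coalgebra.comul (R := k) x = cx
  generalize Coalgebra.comul (R := k) y = cy
  induction cx with
  | zero => simp
  | add a b ha hb => simp only [map_add, add_tmul, add_mul, ha, hb]
  | tmul x₁ x₂ =>
  induction cy with
  | zero => simp
  | add a b ha hb => simp only [map_add, tmul_add, mul_add, ha, hb]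
  | tmul y₁ y₂ => simp

/-- The coaction sends `b₁ ⊗ S(b₂)` to `b₁ ⊗ S(b₃)₁ ⊗ b₂ S(b₃)₂`, and the hypothesis collapses the
last two legs to `S(b₂) ⊗ 1`. The computation is done by convolution in `B ⊗ B ⊗ B`, where `i₁` and
`i₃` embed the outer legs, `m₁` the legs 1 and 3, and `m₂` the legs 2 and 3. -/
theorem IsCoinvariantMap.lTensor_comul_mem {S : B →ₗ[k] B} (hS : IsCoinvariantMap S) (b : B) :
    S.lTensor B (Coalgebra.comul (R := k) b) ∈ boxslash k B := by
  rw [mem_boxslash]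
  let i₁ : B →ₐ[k] (B ⊗[k] B) ⊗[k] B :=
    Algebra.TensorProduct.includeLeft.comp Algebra.TensorProduct.includeLeft
  let i₃ : B →ₐ[k] (B ⊗[k] B) ⊗[k] B := Algebra.TensorProduct.includeRight
  let m₁ : B ⊗[k] B →ₐ[k] (B ⊗[k] B) ⊗[k] B :=
    Algebra.TensorProduct.map (Algebra.TensorProduct.includeLeft : B →ₐ[k] B ⊗[k] B)
      (AlgHom.id k B)
  let m₂ : B ⊗[k] B →ₐ[k] (B ⊗[k] B) ⊗[k] B :=
    Algebra.TensorProduct.map (Algebra.TensorProduct.includeRight : B →ₐ[k] B ⊗[k] B)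
      (AlgHom.id k B)
  have h1 : ∀ z : B ⊗[k] B, coact k B (S.lTensor B z) =
      LinearMap.mul' k _ (TensorProduct.map (m₁.toLinearMap ∘ₗ Coalgebra.comul)
        (m₂.toLinearMap ∘ₗ Coalgebra.comul ∘ₗ S) z) := by
    intro z
    induction z with
    | zero => simp
    | add x y hx hy => simp only [map_add, hx, hy]
    | tmul x y =>
      rw [LinearMap.lTensor_tmul, coact_tmul, TensorProduct.map_tmul, LinearMap.mul'_apply]
      rfl
  have h2 : WithConv.toConv (m₁.toLinearMap ∘ₗ Coalgebra.comul (R := k) (A := B)) =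
      WithConv.toConv i₁.toLinearMap * WithConv.toConv i₃.toLinearMap := by
    refine WithConv.ofConv_injective (LinearMap.ext fun x => ?_)
    simp only [LinearMap.comp_apply, LinearMap.convMul_apply]
    generalize Coalgebra.comul (R := k) x = c
    induction c with
    | zero => simp
    | add x y hx hy => simp only [map_add, hx, hy]
    | tmul x y => simp [m₁, i₁, i₃]
  have h3 : WithConv.toConv i₃.toLinearMap *
      WithConv.toConv (m₂.toLinearMap ∘ₗ Coalgebra.comul (R := k) ∘ₗ S) =
      WithConv.toConv ((m₂.comp Algebra.TensorProduct.includeLeft).toLinearMap ∘ₗ S) := by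
    have h := congrArg (fun f => WithConv.toConv (m₂.toLinearMap ∘ₗ f.ofConv)) hS
    simp only [conv_algHom_comp] at h
    have e : WithConv.toConv i₃.toLinearMap = WithConv.toConv (m₂.toLinearMap ∘ₗ
        (Algebra.TensorProduct.includeRight : B →ₐ[k] B ⊗[k] B).toLinearMap) :=
      WithConv.ofConv_injective (LinearMap.ext fun x => by
        simp [i₃, m₂, Algebra.TensorProduct.one_def])
    rw [e]
    exact h
  have h4 : ∀ z : B ⊗[k] B, LinearMap.mul' k _ (TensorProduct.map i₁.toLinearMap
      ((m₂.comp Algebra.TensorProduct.includeLeft).toLinearMap ∘ₗ S) z) =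
      S.lTensor B z ⊗ₜ (1 : B) := by
    intro z
    induction z with
    | zero => simp
    | add x y hx hy => simp only [map_add, add_tmul, hx, hy]
    | tmul x y => simp [i₁, m₂]
  rw [h1, ← h4]
  have h5 : WithConv.toConv (m₁.toLinearMap ∘ₗ Coalgebra.comul (R := k) (A := B)) *
      WithConv.toConv (m₂.toLinearMap ∘ₗ Coalgebra.comul (R := k) ∘ₗ S) =
      WithConv.toConv i₁.toLinearMap *
      WithConv.toConv ((m₂.comp Algebra.TensorProduct.includeLeft).toLinearMap ∘ₗ S) := by
    rw [h2, mul_assoc, h3]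
  exact LinearMap.congr_fun (congrArg WithConv.ofConv h5) b

theorem idCounit_lTensor_comul {S : B →ₗ[k] B}
    (hS : ∀ a : B, Coalgebra.counit (R := k) (S a) = Coalgebra.counit (R := k) a) (b : B) :
    idCounit k B (S.lTensor B (Coalgebra.comul (R := k) b)) = b := by
  have h : ∀ z : B ⊗[k] B, idCounit k B (S.lTensor B z) =
      TensorProduct.rid k B ((Coalgebra.counit (R := k) (A := B)).lTensor B z) := by
    intro z
    induction z with
    | zero => simp
    | add x y hx hy => simp only [map_add, hx, hy]
    | tmul x y => simp [hS]
  rw [h]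
  simp

theorem IsCoinvariantMap.pMap_surjective {S : B →ₗ[k] B} (hS : IsCoinvariantMap S)
    (hε : ∀ a : B, Coalgebra.counit (R := k) (S a) = Coalgebra.counit (R := k) a) :
    Function.Surjective (pMap k B) := fun b =>
  ⟨⟨_, hS.lTensor_comul_mem b⟩, idCounit_lTensor_comul hε b⟩

/-- Anticomultiplicativity of the antipode is not needed. With `j₁`, `j₂` the two embeddings, `j₁ *
j₂ = Δ`; cancelling `j₁` on the left and `Δ` on the right gives `j₂ * (Δ ∘ S) = j₁ ∘ S`. -/
theorem pMap_surjective_of_hopfAlgebra (H : Type w) [Ring H] [HopfAlgebra k H] :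
    Function.Surjective (pMap k H) := by
  refine IsCoinvariantMap.pMap_surjective (S := HopfAlgebra.antipode k) ?_
    HopfAlgebra.counit_antipode
  let S : H →ₗ[k] H := HopfAlgebra.antipode k
  let j₁ : H →ₐ[k] H ⊗[k] H := Algebra.TensorProduct.includeLeft
  let j₂ : H →ₐ[k] H ⊗[k] H := Algebra.TensorProduct.includeRight
  have hS₁ : WithConv.toConv S * WithConv.toConv LinearMap.id = 1 :=
    congrArg WithConv.toConv HopfAlgebra.mul_antipode_rTensor_comul
  have hS₂ : WithConv.toConv LinearMap.id * WithConv.toConv S = 1 :=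
    congrArg WithConv.toConv HopfAlgebra.mul_antipode_lTensor_comul
  have h1 : WithConv.toConv (j₁.toLinearMap ∘ₗ S) * WithConv.toConv j₁.toLinearMap = 1 := by
    rw [← conv_algHom_comp_one j₁, ← hS₁, conv_algHom_comp]
    rfl
  have h2 : WithConv.toConv (Bialgebra.comulAlgHom k H).toLinearMap *
      WithConv.toConv ((Bialgebra.comulAlgHom k H).toLinearMap ∘ₗ S) = 1 := by
    rw [← conv_algHom_comp_one (Bialgebra.comulAlgHom k H), ← hS₂, conv_algHom_comp]
    rfl
  have h3 : WithConv.toConv j₁.toLinearMap * WithConv.toConv j₂.toLinearMap =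
      WithConv.toConv (Bialgebra.comulAlgHom k H).toLinearMap := by
    refine WithConv.ofConv_injective (LinearMap.ext fun x => ?_)
    simp only [LinearMap.convMul_apply, AlgHom.toLinearMap_apply, Bialgebra.comulAlgHom_apply]
    generalize Coalgebra.comul (R := k) x = c
    induction c with
    | zero => simp
    | add x y hx hy => simp only [map_add, hx, hy]
    | tmul x y => simp [j₁, j₂]
  calc WithConv.toConv j₂.toLinearMap *
        WithConv.toConv ((Bialgebra.comulAlgHom k H).toLinearMap ∘ₗ S)
      = WithConv.toConv (j₁.toLinearMap ∘ₗ S) *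
        ((WithConv.toConv j₁.toLinearMap * WithConv.toConv j₂.toLinearMap) *
        WithConv.toConv ((Bialgebra.comulAlgHom k H).toLinearMap ∘ₗ S)) := by
        rw [mul_assoc, ← mul_assoc, h1, one_mul]
    _ = WithConv.toConv (j₁.toLinearMap ∘ₗ S) := by rw [h3, h2, mul_one]

/-- A right antipode alone does not allow cancelling `j₁` on the left. Anticomultiplicativity
supplies `Δ ∘ S = (j₂ ∘ S) * (j₁ ∘ S)` instead, and `j₂` cancels. -/
theorem IsRightAntipode.isCoinvariantMap {S : B →ₗ[k] B} (hS : IsRightAntipode S)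
    (hanti : IsAntiBialgHom S) : IsCoinvariantMap S := by
  let j₁ : B →ₐ[k] B ⊗[k] B := Algebra.TensorProduct.includeLeft
  let j₂ : B →ₐ[k] B ⊗[k] B := Algebra.TensorProduct.includeRight
  have h1 : WithConv.toConv j₂.toLinearMap * WithConv.toConv (j₂.toLinearMap ∘ₗ S) = 1 := by
    rw [← conv_algHom_comp_one j₂, ← hS, conv_algHom_comp]
    rfl
  have h2 : WithConv.toConv (Coalgebra.comul (R := k) ∘ₗ S) =
      WithConv.toConv (j₂.toLinearMap ∘ₗ S) * WithConv.toConv (j₁.toLinearMap ∘ₗ S) := by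
    refine WithConv.ofConv_injective (LinearMap.ext fun x => ?_)
    simp only [LinearMap.convMul_apply, LinearMap.comp_apply, hanti.comul_map]
    generalize Coalgebra.comul (R := k) x = c
    induction c with
    | zero => simp
    | add x y hx hy => simp only [map_add, hx, hy]
    | tmul x y => simp [j₁, j₂]
  change WithConv.toConv j₂.toLinearMap * _ = WithConv.toConv (j₁.toLinearMap ∘ₗ S)
  rw [h2, ← mul_assoc, h1, one_mul]

theorem IsRightAntipode.eq_lTensor_comul {S : B →ₗ[k] B} (hS : IsRightAntipode S)
    (hanti : IsAntiBialgHom S) {t : B ⊗[k] B} (ht : t ∈ boxslash k B) :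
    t = S.lTensor B (Coalgebra.comul (R := k) (idCounit k B t)) := by
  -- `Θ` is `x ⊗ y ⊗ b ↦ x ⊗ y S(b)`. On `t ⊗ 1` it gives `t`; on the coaction it gives `x₁ ⊗ y₁
  -- S(y₂) S(x₂) = ε(y) x₁ ⊗ S(x₂)`.
  let Θ : (B ⊗[k] B) ⊗[k] B →ₗ[k] B ⊗[k] B :=
    (LinearMap.mul' k B ∘ₗ S.lTensor B).lTensor B ∘ₗ (TensorProduct.assoc k B B B).toLinearMap
  have h1 : ∀ s : B ⊗[k] B, Θ (s ⊗ₜ (1 : B)) = s := by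
    intro s
    induction s with
    | zero => simp
    | add x y hx hy => simp only [add_tmul, map_add, hx, hy]
    | tmul x y => simp [Θ, hanti.map_one]
  have h2 : ∀ s : B ⊗[k] B, Θ (coact k B s) =
      S.lTensor B (Coalgebra.comul (R := k) (idCounit k B s)) := by
    intro s
    induction s with
    | zero => simp
    | add x y hx hy => simp only [map_add, hx, hy]
    | tmul x y =>
    have hy : LinearMap.mul' k B (S.lTensor B (Coalgebra.comul (R := k) y)) =
        algebraMap k B (Coalgebra.counit (R := k) y) :=
      LinearMap.congr_fun (congrArg WithConv.ofConv hS) y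
    rw [idCounit_tmul, map_smul, map_smul]
    generalize Coalgebra.counit (R := k) y = r at hy ⊢
    simp only [coact, LinearMap.comp_apply, TensorProduct.comul_tmul]
    generalize Coalgebra.comul (R := k) x = cx
    induction cx with
    | zero => simp
    | add a b ha hb => simp only [map_add, add_tmul, smul_add, ha, hb]
    | tmul x₁ x₂ =>
    have h3 : ∀ c : B ⊗[k] B, Θ ((LinearMap.mul' k B).lTensor (B ⊗[k] B)
        (AlgebraTensorModule.tensorTensorTensorComm k k k k B B B B ((x₁ ⊗ₜ x₂) ⊗ₜ c))) =
        x₁ ⊗ₜ (LinearMap.mul' k B (S.lTensor B c) * S x₂) := by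
      intro c
      induction c with
      | zero => simp
      | add a b ha hb => simp only [map_add, tmul_add, add_mul, ha, hb]
      | tmul y₁ y₂ => simp [Θ, hanti.map_mul, mul_assoc]
    rw [h3, hy]
    simp [Algebra.algebraMap_eq_smul_one]
  rw [← h2, mem_boxslash.1 ht, h1]

/-- `p` is bijective for a bialgebra with a right antipode that is an anti-bialgebra map. -/
theorem IsRightAntipode.pMap_bijective {S : B →ₗ[k] B} (hS : IsRightAntipode S)
    (hanti : IsAntiBialgHom S) : Function.Bijective (pMap k B) := by
  refine ⟨fun s t hst => Subtype.ext ?_,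
    (hS.isCoinvariantMap hanti).pMap_surjective hanti.counit_map⟩
  have h : idCounit k B s.1 = idCounit k B t.1 := hst
  rw [hS.eq_lTensor_comul hanti s.2, hS.eq_lTensor_comul hanti t.2, h]

theorem lTensor_mem_boxslash {L : B →ₗ[k] B}
    (hL : ∀ x, Coalgebra.comul (R := k) (L x) = L.rTensor B (Coalgebra.comul (R := k) x))
    {t : B ⊗[k] B} (ht : t ∈ boxslash k B) : L.lTensor B t ∈ boxslash k B := by
  rw [mem_boxslash] at *
  have : ∀ s : B ⊗[k] B,
      coact k B (L.lTensor B s) = (L.lTensor B).rTensor B (coact k B s) := by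
    intro s
    induction s with
    | zero => simp
    | add a b ha hb => simp only [map_add, ha, hb]
    | tmul x y =>
      simp only [coact, LinearMap.comp_apply, LinearMap.lTensor_tmul, TensorProduct.comul_tmul, hL]
      generalize Coalgebra.comul (R := k) x = cx
      generalize Coalgebra.comul (R := k) y = cy
      induction cx with
      | zero => simp
      | add a b ha hb => simp only [map_add, add_tmul, ha, hb]
      | tmul x₁ x₂ =>
      induction cy with
      | zero => simp
      | add a b ha hb => simp only [map_add, tmul_add, ha, hb]
      | tmul y₁ y₂ => simp
  rw [this, ht, LinearMap.rTensor_tmul]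

variable (k B) in
/-- The map `B ⊗ B → B`, `x ⊗ y ↦ ε(x) y`. -/
def counitId : B ⊗[k] B →ₗ[k] B :=
  (TensorProduct.lid k B).toLinearMap ∘ₗ (Coalgebra.counit (R := k) (A := B)).rTensor B

@[simp] theorem counitId_tmul (x y : B) :
    counitId k B (x ⊗ₜ y) = Coalgebra.counit (R := k) x • y := by simp [counitId]

theorem counitId_twMul (s t : B ⊗[k] B) :
    counitId k B (twMul s t) = counitId k B t * counitId k B s := by
  induction s with
  | zero => simp
  | add a b ha hb => simp only [map_add, LinearMap.add_apply, ha, hb, mul_add]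
  | tmul u v =>
  induction t with
  | zero => simp
  | add a b ha hb => simp only [map_add, ha, hb, add_mul]
  | tmul x y => simp [twMul_tmul, smul_smul]

theorem counit_counitId (t : B ⊗[k] B) : Coalgebra.counit (R := k) (counitId k B t) =
    Coalgebra.counit (R := k) (idCounit k B t) := by
  induction t with
  | zero => simp
  | add a b ha hb => simp only [map_add, ha, hb]
  | tmul x y => simp [mul_comm]

/-- The left slice map `x ↦ φ(x₁) x₂`. -/
def leftSlice (φ : B →ₗ[k] k) : B →ₗ[k] B :=
  (TensorProduct.lid k B).toLinearMap ∘ₗ φ.rTensor B ∘ₗ Coalgebra.comul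

theorem comul_leftSlice (φ : B →ₗ[k] k) (x : B) : Coalgebra.comul (R := k) (leftSlice φ x) =
    (leftSlice φ).rTensor B (Coalgebra.comul (R := k) x) := slice_comul φ x

theorem counit_leftSlice (φ : B →ₗ[k] k) (x : B) :
    Coalgebra.counit (R := k) (leftSlice φ x) = φ x := by
  have h : ∀ z : B ⊗[k] B, Coalgebra.counit (R := k) (TensorProduct.lid k B (φ.rTensor B z)) =
      φ (TensorProduct.rid k B ((Coalgebra.counit (R := k) (A := B)).lTensor B z)) := by
    intro z
    induction z with
    | zero => simp
    | add a b ha hb => simp only [map_add, ha, hb]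
    | tmul a b => simp [mul_comm]
  exact (h _).trans (by simp)

/-- If `p` is bijective, then `B` has a right antipode which is an anti-bialgebra map. -/
theorem exists_rightAntipode_of_bijective (hp : Function.Bijective (pMap k B)) :
    ∃ S : B →ₗ[k] B, IsRightAntipode S ∧ IsAntiBialgHom S := by
  let e := LinearEquiv.ofBijective (pMap k B) hp
  let q : B →ₗ[k] B ⊗[k] B := (boxslash k B).subtype ∘ₗ e.symm.toLinearMap
  have hq : ∀ b, q b ∈ boxslash k B := fun b => (e.symm b).2
  have hpq : ∀ b, idCounit k B (q b) = b := fun b => e.apply_symm_apply b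
  have hqp : ∀ {t}, t ∈ boxslash k B → q (idCounit k B t) = t := fun {t} ht =>
    congrArg Subtype.val (e.symm_apply_apply ⟨t, ht⟩)
  let S : B →ₗ[k] B := counitId k B ∘ₗ q
  -- `p` commutes with slicing the left leg, hence so does its inverse `q`; applying `ε` to the left
  -- leg recovers every slice of `q b` from `S`.
  have hqS : ∀ b, q b = S.lTensor B (Coalgebra.comul (R := k) b) := by
    intro b
    refine ext_rTensor fun φ => ?_
    have h1 := hqp (rTensor_mem_boxslash (comul_leftSlice φ) (hq b))
    have h2 : ∀ t : B ⊗[k] B, idCounit k B ((leftSlice φ).rTensor B t) =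
        leftSlice φ (idCounit k B t) := by
      intro t
      induction t with
      | zero => simp
      | add a b ha hb => simp only [map_add, ha, hb]
      | tmul x y => simp
    have h3 : ∀ t : B ⊗[k] B, counitId k B ((leftSlice φ).rTensor B t) =
        TensorProduct.lid k B (φ.rTensor B t) := by
      intro t
      induction t with
      | zero => simp
      | add a b ha hb => simp only [map_add, ha, hb]
      | tmul x y => simp [counit_leftSlice]
    have h4 : ∀ t : B ⊗[k] B, TensorProduct.lid k B (φ.rTensor B (S.lTensor B t)) =
        S (TensorProduct.lid k B (φ.rTensor B t)) := by
      intro t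
      induction t with
      | zero => simp
      | add a b ha hb => simp only [map_add, ha, hb]
      | tmul x y => simp
    rw [h2, hpq] at h1
    rw [← h3, ← h1, h4]
    rfl
  refine ⟨S, ?_, ?_, ?_, ?_, ?_⟩
  · refine WithConv.ofConv_injective (LinearMap.ext fun b => ?_)
    have h1 : LinearMap.mul' k B (S.lTensor B (Coalgebra.comul (R := k) b)) =
        algebraMap k B (Coalgebra.counit (R := k) b) := by
      rw [← hqS, mul'_of_mem_boxslash (hq b), hpq]
    exact h1
  · have h := hqp (one_mem_boxslash (k := k) (B := B))
    simp only [idCounit_tmul, Bialgebra.counit_one, one_smul] at h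
    simp [S, h]
  · intro a b
    have h := hqp (twMul_mem (hq a) (hq b))
    rw [idCounit_twMul, hpq, hpq] at h
    simp only [S, LinearMap.comp_apply, h, counitId_twMul]
  · intro a
    simp only [S, LinearMap.comp_apply, counit_counitId, hpq]
  · intro b
    refine ext_rTensor fun ψ => ?_
    -- Slicing the right leg also preserves `B ⊠ B`, and `p` of the result is `b₁ ψ(S(b₂))`. Hence
    -- `ψ(S(b)₁) S(b)₂ = S(b₁) ψ(S(b₂))`, which is a slice of anticomultiplicativity.
    have h1 := hqp (lTensor_mem_boxslash (comul_leftSlice ψ) (hq b))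
    have h2 : ∀ t : B ⊗[k] B, counitId k B ((leftSlice ψ).lTensor B t) =
        leftSlice ψ (counitId k B t) := by
      intro t
      induction t with
      | zero => simp
      | add a b ha hb => simp only [map_add, ha, hb]
      | tmul x y => simp
    have h3 : ∀ t : B ⊗[k] B, S (idCounit k B ((leftSlice ψ).lTensor B (S.lTensor B t))) =
        TensorProduct.lid k B (ψ.rTensor B
          (TensorProduct.map S S (TensorProduct.comm k B B t))) := by
      intro t
      induction t with
      | zero => simp
      | add a b ha hb => simp only [map_add, ha, hb]
      | tmul x y => simp [counit_leftSlice]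
    rw [← h3, ← hqS]
    refine Eq.trans ?_ (congrArg (counitId k B) h1).symm
    rw [h2]
    rfl

end Antipode

/-! ### Bijectivity of p on K^∞ and the cofree Hopf algebra -/

section KInfinity

variable {k : Type u} [Field k]

theorem coact_map {A : Type w} [Ring A] [Bialgebra k A] {B : Type v} [Ring B] [Bialgebra k B]
    (f : A →ₐc[k] B) (s : A ⊗[k] A) :
    coact k B (TensorProduct.map (f : A →ₗ[k] B) (f : A →ₗ[k] B) s) =
      TensorProduct.map (TensorProduct.map (f : A →ₗ[k] B) (f : A →ₗ[k] B)) (f : A →ₗ[k] B)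
        (coact k A s) := by
  induction s with
  | zero => simp
  | add a b ha hb => simp only [map_add, ha, hb]
  | tmul x y =>
    have hf : ∀ z, Coalgebra.comul (R := k) (f z) =
      TensorProduct.map (f : A →ₗ[k] B) (f : A →ₗ[k] B) (Coalgebra.comul z) :=
      fun z => (CoalgHomClass.map_comp_comul_apply f z).symm
    simp only [coact, LinearMap.comp_apply, TensorProduct.map_tmul, TensorProduct.comul_tmul]
    rw [show (f : A →ₗ[k] B) x = f x from rfl, show (f : A →ₗ[k] B) y = f y from rfl, hf, hf]
    generalize Coalgebra.comul (R := k) x = cx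
    generalize Coalgebra.comul (R := k) y = cy
    induction cx with
    | zero => simp
    | add a b ha hb => simp only [map_add, add_tmul, ha, hb]
    | tmul x₁ x₂ =>
    induction cy with
    | zero => simp
    | add a b ha hb => simp only [map_add, tmul_add, ha, hb]
    | tmul y₁ y₂ => simp

/-- Tensor powers of an injective map over a field are injective, so coinvariance can be tested in
`B`. -/
theorem mem_boxslash_of_map_mem {A : Type w} [Ring A] [Bialgebra k A] {B : Type v} [Ring B]
    [Bialgebra k B] {f : A →ₐc[k] B} (hf : Function.Injective f) {s : A ⊗[k] A}
    (hs : TensorProduct.map (f : A →ₗ[k] B) (f : A →ₗ[k] B) s ∈ boxslash k B) :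
    s ∈ boxslash k A := by
  rw [mem_boxslash] at *
  refine TensorProduct.map_injective_of_flat_flat
    (TensorProduct.map (f : A →ₗ[k] B) (f : A →ₗ[k] B)) (f : A →ₗ[k] B)
    (TensorProduct.map_injective_of_flat_flat _ _ hf hf) hf ?_
  rw [← coact_map, hs]
  simp

theorem mem_range_pMap_of_mem_KB {B : Type v} [Ring B] [Bialgebra k B] {b : B}
    (hb : b ∈ (KB k B).toSubalgebra) : b ∈ LinearMap.range (pMap k B) := by
  have h : Coalgebra.comul (R := k) b ∈
      LinearMap.range ((LinearMap.range (pMap k B)).subtype.rTensor B) := hb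
  rw [mem_range_rTensor_iff] at h
  simpa using h Coalgebra.counit

theorem mem_KB_of_pMap_surjective {B : Type v} [Ring B] [Bialgebra k B]
    (hB : Function.Surjective (pMap k B)) (b : B) : b ∈ (KB k B).toSubalgebra :=
  (mem_range_rTensor_iff _ _).2 fun _ => hB _

theorem pMap_surjective_of_surjective {A : Type w} [Ring A] [Bialgebra k A] {B : Type v} [Ring B]
    [Bialgebra k B] (f : A →ₐc[k] B) (hf : Function.Surjective f)
    (hA : Function.Surjective (pMap k A)) : Function.Surjective (pMap k B) := fun b => by
  obtain ⟨a, rfl⟩ := hf b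
  exact map_mem_range_pMap f (hA a)

theorem pMap_KB_surjective {B : Type v} [Ring B] [Bialgebra k B]
    (hB : Function.Surjective (pMap k B)) :
    Function.Surjective (pMap k (KB k B).toSubalgebra) :=
  pMap_surjective_of_surjective
    ((KB k B).codRestrict (BialgHom.id k B) (mem_KB_of_pMap_surjective hB))
    (fun b => ⟨b.1, rfl⟩) hB

/-- Surjectivity of `p` gives `K(B) = B`. It has to be carried along the induction so that the next
application of `K` again removes nothing. -/
theorem iterTo_surjective {B : BialgCat.{v} k} (hB : Function.Surjective (pMap k B)) (n : ℕ) :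
    Function.Surjective (pMap k ((iter (K k) n).obj B)) ∧
      Function.Surjective ((iterTo (K k) (kappa k) n).app B).toBialgHom := by
  induction n with
  | zero => exact ⟨hB, fun b => ⟨b, rfl⟩⟩
  | succ n ih =>
    refine ⟨pMap_KB_surjective ih.1, fun b => ?_⟩
    obtain ⟨c, rfl⟩ := ih.2 b
    exact ⟨(⟨c, mem_KB_of_pMap_surjective ih.1 c⟩ :
      (KB k ((iter (K k) n).obj B)).toSubalgebra), rfl⟩

theorem apply_mem_KinfB {A : BialgCat.{v} k} (hA : Function.Surjective (pMap k A))
    {B : BialgCat.{v} k} (f : A ⟶ B) (a : A) : f.toBialgHom a ∈ (KinfB k B).toSubalgebra :=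
  map_mem_KinfB f (mem_KinfB.2 fun n => (iterTo_surjective hA n).2 a)

theorem mem_range_map_iInter {B : Type v} [Ring B] [Bialgebra k B] {ι : Type w}
    (V : ι → SubBialgebra k B) {t : B ⊗[k] B}
    (ht : ∀ i, t ∈ LinearMap.range (TensorProduct.map (V i).incl (V i).incl)) :
    t ∈ LinearMap.range (TensorProduct.map (iInter V).incl (iInter V).incl) := by
  refine (mem_range_map_iff (Subalgebra.toSubmodule (iInter V).toSubalgebra) t).2 ⟨?_, ?_⟩
  · refine (mem_range_rTensor_iff _ _).2 fun φ => Algebra.mem_iInf.2 fun i => ?_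
    exact (mem_range_rTensor_iff _ _).1 ((mem_range_map_iff
      (Subalgebra.toSubmodule (V i).toSubalgebra) t).1 (ht i)).1 φ
  · refine (mem_range_lTensor_iff _ _).2 fun φ => Algebra.mem_iInf.2 fun i => ?_
    exact (mem_range_lTensor_iff _ _).1 ((mem_range_map_iff
      (Subalgebra.toSubmodule (V i).toSubalgebra) t).1 (ht i)).2 φ

theorem map_mem_range_map_range {A : Type w} [Ring A] [Bialgebra k A] {B : Type v} [Ring B]
    [Bialgebra k B] (f : A →ₐc[k] B) (s : A ⊗[k] A) :
    TensorProduct.map (f : A →ₗ[k] B) (f : A →ₗ[k] B) s ∈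
      LinearMap.range (TensorProduct.map (range f).incl (range f).incl) := by
  let r : A →ₗ[k] (range f).toSubalgebra := ((range f).codRestrict f fun a => ⟨a, rfl⟩ : _ →ₐc[k] _)
  exact ⟨TensorProduct.map r r s,
    (LinearMap.congr_fun (TensorProduct.map_comp (range f).incl (range f).incl r r) s).symm⟩

/-- If `p_B` is injective, then `p` is bijective for `K^∞(B)`. -/
theorem pMap_KinfB_bijective {B : BialgCat.{v} k} (hB : Function.Injective (pMap k B)) :
    Function.Bijective (pMap k (KinfB k B).toSubalgebra) := by
  refine ⟨pMap_injective_of_injective (KinfB k B).val (KinfB k B).val_injective hB, fun b => ?_⟩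
  let i : ∀ n, (iter (K k) n).obj B →ₐc[k] B := fun n =>
    ((iterTo (K k) (kappa k) n).app B).toBialgHom
  have h1 : ∀ n, ∃ s ∈ boxslash k ((iter (K k) n).obj B), i n (idCounit k _ s) = b.1 := by
    intro n
    -- The shift matters: lying in `K(K^n(B))` puts the element in the image of `p` for `K^n(B)`.
    obtain ⟨c, hc⟩ := mem_KinfB.1 b.2 (n + 1)
    let c' : (KB k ((iter (K k) n).obj B)).toSubalgebra := c
    obtain ⟨s, hs, hsc⟩ := mem_range_pMap.1 (mem_range_pMap_of_mem_KB c'.2)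
    exact ⟨s, hs, by rw [hsc]; exact hc⟩
  choose s hs hsb using h1
  let t : ∀ n, boxslash k B := fun n => ⟨_, map_mem_boxslash (i n) (hs n)⟩
  have ht : ∀ n, pMap k B (t n) = b.1 := fun n => (idCounit_map (i n) (s n)).trans (hsb n)
  -- Injectivity of `p_B` identifies the preimages found at all stages, so one tensor lies in every
  -- `K^n ⊗ K^n`.
  have ht0 : ∀ n, t n = t 0 := fun n => hB ((ht n).trans (ht 0).symm)
  have hmem : (t 0).1 ∈
      LinearMap.range (TensorProduct.map (KinfB k B).incl (KinfB k B).incl) := by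
    refine mem_range_map_iInter _ fun n => ?_
    rw [← ht0 n]
    exact map_mem_range_map_range (i n) (s n)
  obtain ⟨r, hr⟩ := hmem
  have hr' : TensorProduct.map ((KinfB k B).val : _ →ₗ[k] B) ((KinfB k B).val : _ →ₗ[k] B) r =
      (t 0).1 := hr
  refine mem_range_pMap.2 ⟨r, mem_boxslash_of_map_mem (KinfB k B).val_injective
    (hr' ▸ (t 0).2), (KinfB k B).val_injective ?_⟩
  rw [← idCounit_map, hr']
  exact ht 0

/-- For a locally left `n`-Hopf bialgebra `B`, `K^∞(B)` is the cofree Hopf algebra on `B`. -/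
theorem IsLocallyLeftNHopf.isCofreeHopf {B : Type v} [Ring B] [Bialgebra k B]
    (h : IsLocallyLeftNHopf k B) :
    IsCofreeHopf.{u, v, w} (KinfB k (BialgCat.of k B)).val where
  exists_antipode := by
    obtain ⟨S, hS, -⟩ := exists_rightAntipode_of_bijective
      (pMap_KinfB_bijective (B := BialgCat.of k B) h.pMap_injective)
    have hS' := h.leftAntipode (KinfB k (BialgCat.of k B)).val_injective hS
    exact ⟨{ (inferInstance : Bialgebra k (KinfB k (BialgCat.of k B)).toSubalgebra) with
      antipode := S
      mul_antipode_rTensor_comul := congrArg WithConv.ofConv hS'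
      mul_antipode_lTensor_comul := congrArg WithConv.ofConv hS }, rfl⟩
  existsUnique_lift := fun H _ _ f => by
    -- Passing to the image of `f` replaces `H` by a bialgebra in the universe of `B`, to which
    -- `apply_mem_KinfB` applies.
    have hsurj : Function.Surjective (pMap k (range f).toSubalgebra) :=
      pMap_surjective_of_surjective ((range f).codRestrict f fun a => ⟨a, rfl⟩)
        (fun b => b.2.imp fun a ha => Subtype.ext ha) (pMap_surjective_of_hopfAlgebra H)
    have hmem : ∀ a, f a ∈ (KinfB k (BialgCat.of k B)).toSubalgebra := fun a =>
      apply_mem_KinfB (A := BialgCat.of k (range f).toSubalgebra) (B := BialgCat.of k B) hsurj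
        (BialgCat.ofHom (range f).val) (⟨f a, a, rfl⟩ : (range f).toSubalgebra)
    refine ⟨(KinfB k (BialgCat.of k B)).codRestrict f hmem, rfl, fun g hg => ?_⟩
    refine DFunLike.ext _ _ fun a => Subtype.ext ?_
    exact DFunLike.congr_fun hg a

end KInfinity

/-! ### A criterion for right adjoints of fully faithful functors -/

section Coreflection

/-- If `σ : G ⟶ 𝟭` is a componentwise mono through which every map out of an object in the image
of the fully faithful functor `L` factors, and the values of `G` lie in the image of `L`, then `L`
has a right adjoint with counit `σ`. -/
theorem exists_rightAdjoint_counit_eq {C D : Type*} [Category* C] [Category* D] (L : D ⥤ C)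
    [L.Full] [L.Faithful] {G : C ⥤ C} (σ : G ⟶ 𝟭 C) (hσ : ∀ B, Mono (σ.app B)) (r : C → D)
    (e : ∀ B, L.obj (r B) ≅ G.obj B)
    (h : ∀ (A : D) (B : C) (f : L.obj A ⟶ B), ∃ g : L.obj A ⟶ G.obj B, g ≫ σ.app B = f) :
    ∃ (R : C ⥤ D) (adj : L ⊣ R) (i : R ⋙ L ≅ G), adj.counit = i.hom ≫ σ := by
  choose g hg using h
  -- The assignment `r` is given on objects only; fullness transports the functoriality of `G` along
  -- `e`.
  let R : C ⥤ D :=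
    { obj := r
      map := fun {B B'} f => L.preimage ((e B).hom ≫ G.map f ≫ (e B').inv)
      map_id := fun B => L.map_injective (by simp)
      map_comp := fun f f' => L.map_injective (by simp) }
  have hR : ∀ {B B' : C} (f : B ⟶ B'), L.map (R.map f) = (e B).hom ≫ G.map f ≫ (e B').inv :=
    fun f => L.map_preimage _
  let core : Adjunction.CoreHomEquiv L R :=
    { homEquiv := fun A B =>
        { toFun := fun f => L.preimage (g A B f ≫ (e B).inv)
          invFun := fun f => L.map f ≫ (e B).hom ≫ σ.app B
          left_inv := fun f => by simp [hg]
          right_inv := fun f => L.map_injective (by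
            have := hσ B
            rw [L.map_preimage, ← cancel_mono (e B).hom, ← cancel_mono (σ.app B)]
            simp [hg]) }
      homEquiv_naturality_left_symm := fun f f' => by simp
      homEquiv_naturality_right := fun {A B B'} f f' => L.map_injective (by
        have := hσ B'
        change L.map (L.preimage _) = L.map (L.preimage _ ≫ _)
        rw [L.map_comp, L.map_preimage, L.map_preimage, hR, ← cancel_mono (e B').hom,
          ← cancel_mono (σ.app B')]
        simp only [Category.assoc, Iso.inv_hom_id, Category.comp_id, Iso.inv_hom_id_assoc,
          σ.naturality, hg, Functor.id_map]
        rw [← Category.assoc, hg]) }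
  refine ⟨R, Adjunction.mkOfHomEquiv core, NatIso.ofComponents e fun f => ?_, ?_⟩
  · rw [Functor.comp_map, hR]
    simp
  · ext B
    simp [core, R]

end Coreflection

/-! ### Limits and adjunctions in Bialg^in -/

section Categories

variable {k : Type u} [Field k]

theorem hom_injective_of_comp_eq {A B C : BialgCat.{v} k} {f g : A ⟶ B} {h : B ⟶ C}
    (hh : Function.Injective h.toBialgHom) (e : f ≫ h = g ≫ h) : f = g := by
  refine BialgCat.hom_ext _ _ (DFunLike.ext _ _ fun a => hh ?_)
  exact congrArg (fun l : A ⟶ C => l.toBialgHom a) e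

theorem BialgIn.mono_of_injective {A B : BialgIn.{u, v} k} (f : A ⟶ B)
    (hf : Function.Injective f.hom.toBialgHom) : Mono f where
  right_cancellation _ _ e :=
    ObjectProperty.hom_ext _ (hom_injective_of_comp_eq hf (congrArg (·.hom) e))

instance mono_kappaIn_app (B : BialgIn.{u, v} k) : Mono ((kappaIn k).app B) :=
  BialgIn.mono_of_injective _ (KB k B.obj).val_injective

instance mono_sigmaInfIn_app (B : BialgIn.{u, v} k) : Mono ((sigmaInfIn k).app B) :=
  BialgIn.mono_of_injective _ (KinfB k B.obj).val_injective

theorem isWellCopointed_Kin : IsWellCopointed (Kin.{u, v} k) (kappaIn.{u, v} k) := fun _ => rfl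

theorem isIso_kappaIn_app {B : BialgIn.{u, v} k} (hB : Function.Surjective (pMap k B.obj)) :
    IsIso ((kappaIn k).app B) := by
  refine ⟨ObjectProperty.homMk (BialgCat.ofHom ((KB k B.obj).codRestrict (BialgHom.id k B.obj)
    (mem_KB_of_pMap_surjective hB))), rfl, rfl⟩

/-- A section of the inclusion forces `K(B) = B`, and `K(B)` lies in the image of `p`. -/
theorem pMap_surjective_of_comp_kappaIn {B : BialgIn.{u, v} k} {ρ : B ⟶ (Kin k).obj B}
    (h : ρ ≫ (kappaIn k).app B = 𝟙 B) : Function.Surjective (pMap k B.obj) := fun b => by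
  have h1 : ((KB k B.obj).val (ρ.hom.toBialgHom b) : B.obj) = b :=
    congrArg (fun f : B ⟶ B => f.hom.toBialgHom b) h
  have h2 := mem_range_pMap_of_mem_KB
    (b := ((KB k B.obj).val (ρ.hom.toBialgHom b) : B.obj)) (Subtype.prop _)
  rwa [h1] at h2

theorem exists_lift_KinfIn {A B : BialgIn.{u, v} k} (hA : Function.Surjective (pMap k A.obj))
    (f : A ⟶ B) : ∃ g : A ⟶ (KinfIn k).obj B, g ≫ (sigmaInfIn k).app B = f :=
  ⟨ObjectProperty.homMk (BialgCat.ofHom ((KinfB k B.obj).codRestrict f.hom.toBialgHom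
    (apply_mem_KinfB hA f.hom))), rfl⟩

/-- Being a `K`-coalgebra is a property: `k` is monic and both coactions are sections of it, so
every bialgebra map respects them. -/
instance full_forget : (CopointedCoalg.forget (Kin.{u, v} k) (kappaIn.{u, v} k)).Full where
  map_surjective {A A'} f := by
    have hA : A.obj.str ≫ (kappaIn k).app A.obj.V = 𝟙 _ := A.property
    have hA' : A'.obj.str ≫ (kappaIn k).app A'.obj.V = 𝟙 _ := A'.property
    have key : ∀ f : A.obj.V ⟶ A'.obj.V, A.obj.str ≫ (Kin k).map f = f ≫ A'.obj.str := by
      intro f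
      have hn : (Kin k).map f ≫ (kappaIn k).app A'.obj.V = (kappaIn k).app A.obj.V ≫ f :=
        (kappaIn k).naturality f
      rw [← cancel_mono ((kappaIn k).app A'.obj.V), Category.assoc, hn, ← Category.assoc, hA,
        Category.assoc, hA', Category.id_comp, Category.comp_id]
    exact ⟨ObjectProperty.homMk ⟨f, key f⟩, rfl⟩

instance faithful_forget :
    (CopointedCoalg.forget (Kin.{u, v} k) (kappaIn.{u, v} k)).Faithful where
  map_injective {A A'} f g h := by
    apply ObjectProperty.hom_ext
    exact Endofunctor.Coalgebra.ext h

/-- The comparison of the iterates of `K` on `Bialg^in` and on all bialgebras. -/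
theorem exists_iter_iso (B : BialgIn.{u, v} k) (n : ℕ) :
    ∃ e : ((iter (Kin k) n).obj B).obj ≅ (iter (K k) n).obj B.obj,
      e.hom ≫ (iterTo (K k) (kappa k) n).app B.obj = ((iterTo (Kin k) (kappaIn k) n).app B).hom := by
  induction n with
  | zero => exact ⟨Iso.refl _, rfl⟩
  | succ n ih =>
    obtain ⟨e, he⟩ := ih
    refine ⟨(K k).mapIso e, ?_⟩
    have h1 : (iterTo (K k) (kappa k) (n + 1)).app B.obj =
      (kappa k).app ((iter (K k) n).obj B.obj) ≫ (iterTo (K k) (kappa k) n).app B.obj := rfl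
    have h2 : ((iterTo (Kin k) (kappaIn k) (n + 1)).app B).hom =
      (kappa k).app ((iter (Kin k) n).obj B).obj ≫
        ((iterTo (Kin k) (kappaIn k) n).app B).hom := rfl
    rw [h1, h2, ← he]
    rfl

theorem iterTo_Kin_injective (B : BialgIn.{u, v} k) (n : ℕ) :
    Function.Injective ((iterTo (Kin k) (kappaIn k) n).app B).hom.toBialgHom := by
  induction n with
  | zero => exact fun _ _ h => h
  | succ n ih => exact fun c d h => Subtype.ext (ih h)

theorem exists_comp_eq_of_subset_range {A B C : BialgCat.{v} k} (i : A ⟶ B) (f : C ⟶ B)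
    (hi : Function.Injective i.toBialgHom)
    (hf : ∀ c, ∃ a, i.toBialgHom a = f.toBialgHom c) : ∃ g : C ⟶ A, g ≫ i = f := by
  let e := BialgEquiv.ofBijective ((range i.toBialgHom).codRestrict i.toBialgHom fun a => ⟨a, rfl⟩)
    ⟨fun a b h => hi (congrArg Subtype.val h), fun b => b.2.imp fun a ha => Subtype.ext ha⟩
  refine ⟨BialgCat.ofHom ((e.symm : _ →ₐc[k] A).comp
    ((range i.toBialgHom).codRestrict f.toBialgHom hf)),
    BialgCat.hom_ext _ _ (DFunLike.ext _ _ fun c => ?_)⟩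
  exact congrArg Subtype.val (e.apply_symm_apply _)

theorem mem_KinfB_iff_Kin {B : BialgIn.{u, v} k} {b : B.obj} :
    b ∈ (KinfB k B.obj).toSubalgebra ↔ ∀ n, ∃ c : ((iter (Kin k) n).obj B).obj,
      ((iterTo (Kin k) (kappaIn k) n).app B).hom.toBialgHom c = b := by
  refine mem_KinfB.trans (forall_congr' fun n => ?_)
  obtain ⟨e, he⟩ := exists_iter_iso B n
  rw [← he]
  constructor
  · rintro ⟨c, rfl⟩
    exact ⟨e.inv.toBialgHom c, congrArg (((iterTo (K k) (kappa k) n).app B.obj).toBialgHom)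
      (congrArg (fun l : (iter (K k) n).obj B.obj ⟶ _ => l.toBialgHom c) e.inv_hom_id)⟩
  · rintro ⟨c, rfl⟩
    exact ⟨e.hom.toBialgHom c, rfl⟩

/-- All maps to `B` are monic, so a cone is determined by its component at `0`, whose image lies in
every `K^n(B)` and hence in `K^∞(B)`. -/
theorem exists_isLimit_cofreeSeq (B : BialgIn.{u, v} k) :
    ∃ π : (Functor.const ℕᵒᵖ).obj ((KinfIn k).obj B) ⟶ cofreeSeq (Kin k) (kappaIn k) B,
      π.app (Opposite.op 0) = (sigmaInfIn k).app B ∧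
      Nonempty (Limits.IsLimit (Limits.Cone.mk ((KinfIn k).obj B) π)) := by
  let i : ∀ n, (iter (Kin k) n).obj B ⟶ B := fun n => (iterTo (Kin k) (kappaIn k) n).app B
  have hi : ∀ n, Mono (i n) := fun n => BialgIn.mono_of_injective _ (iterTo_Kin_injective B n)
  have hsucc : ∀ n, (kappaIn k).app ((iter (Kin k) n).obj B) ≫ i n = i (n + 1) := fun n => rfl
  have hlift : ∀ n, ∃ g : (KinfIn k).obj B ⟶ (iter (Kin k) n).obj B,
      g ≫ i n = (sigmaInfIn k).app B := by
    intro n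
    obtain ⟨g, hg⟩ := exists_comp_eq_of_subset_range (i n).hom ((sigmaInfIn k).app B).hom
      (iterTo_Kin_injective B n) fun c => mem_KinfB_iff_Kin.1 c.2 n
    exact ⟨ObjectProperty.homMk g, ObjectProperty.hom_ext _ hg⟩
  choose g hg using hlift
  have hmap : ∀ n, (cofreeSeq (Kin k) (kappaIn k) B).map (homOfLE (Nat.le_add_right n 1)).op =
      (kappaIn k).app ((iter (Kin k) n).obj B) := fun n =>
    Functor.ofOpSequence_map_homOfLE_succ _ n
  have hgsucc : ∀ n, g (n + 1) ≫ (kappaIn k).app ((iter (Kin k) n).obj B) = g n := fun n => by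
    rw [← cancel_mono (i n), hg]
    exact (Category.assoc _ _ _).trans (hg (n + 1))
  let π : (Functor.const ℕᵒᵖ).obj ((KinfIn k).obj B) ⟶ cofreeSeq (Kin k) (kappaIn k) B :=
    NatTrans.ofOpSequence (fun n => g n) fun n => by
      rw [hmap]
      exact (Category.id_comp (g n)).trans (hgsucc n).symm
  have hs : ∀ (s : Limits.Cone (cofreeSeq (Kin k) (kappaIn k) B)) (n : ℕ),
      s.π.app (Opposite.op n) ≫ i n = s.π.app (Opposite.op 0) := by
    intro s n
    induction n with
    | zero => exact Category.comp_id _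
    | succ n ih =>
      have hw := s.w (homOfLE (Nat.le_add_right n 1)).op
      rw [hmap] at hw
      rw [← ih, ← hsucc, ← hw]
      exact (Category.assoc _ _ _).symm
  have hmem : ∀ (s : Limits.Cone (cofreeSeq (Kin k) (kappaIn k) B)),
      ∃ l : s.pt ⟶ (KinfIn k).obj B,
        l ≫ (sigmaInfIn k).app B = s.π.app (Opposite.op 0) := by
    intro s
    obtain ⟨l, hl⟩ := exists_comp_eq_of_subset_range ((sigmaInfIn k).app B).hom
      (s.π.app (Opposite.op 0)).hom (KinfB k B.obj).val_injective fun c =>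
        ⟨⟨_, mem_KinfB_iff_Kin.2 fun n => ⟨(s.π.app (Opposite.op n)).hom.toBialgHom c,
          congrArg (fun l : s.pt ⟶ B => l.hom.toBialgHom c) (hs s n)⟩⟩, rfl⟩
    exact ⟨ObjectProperty.homMk l, ObjectProperty.hom_ext _ hl⟩
  choose l hl using hmem
  refine ⟨π, (Category.comp_id _).symm.trans (hg 0), ⟨?_⟩⟩
  refine { lift := l, fac := fun s j => ?_, uniq := fun s m hm => ?_ }
  · obtain ⟨n⟩ := j
    refine (cancel_mono (i n)).1 ?_
    change (l s ≫ g n) ≫ i n = _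
    rw [Category.assoc, hg, hl]
    exact (hs s n).symm
  · rw [← cancel_mono ((sigmaInfIn k).app B), hl, ← hm]
    change _ = m ≫ g 0
    rw [← hg 0]
    exact congrArg (m ≫ ·) (Category.comp_id _)

theorem exists_cofree_copointedCoalg :
    ∃ (R : BialgIn.{u, v} k ⥤ CopointedCoalg (Kin.{u, v} k) (kappaIn.{u, v} k))
      (adj : CopointedCoalg.forget _ _ ⊣ R)
      (e : R ⋙ CopointedCoalg.forget _ _ ≅ KinfIn.{u, v} k),
      adj.counit = e.hom ≫ sigmaInfIn k := by
  have hiso : ∀ B : BialgIn.{u, v} k, IsIso ((kappaIn k).app ((KinfIn k).obj B)) := fun B =>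
    isIso_kappaIn_app (pMap_KinfB_bijective B.property).2
  refine exists_rightAdjoint_counit_eq _ (sigmaInfIn k) inferInstance
    -- The coaction on `K^∞(B)` is the inverse of `k`, which exists because `p` is bijective there.
    (fun B => ⟨⟨(KinfIn k).obj B, inv ((kappaIn k).app ((KinfIn k).obj B))⟩,
      IsIso.inv_hom_id _⟩) (fun B => Iso.refl _) fun A B f => ?_
  exact exists_lift_KinfIn (A := A.obj.V) (pMap_surjective_of_comp_kappaIn A.property) f

theorem isRightHopfAnti_le_pInjective : isRightHopfAnti.{u, v} k ≤ pInjective.{u, v} k :=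
  fun _ ⟨_, hS, hanti⟩ => (hS.pMap_bijective hanti).1

theorem exists_coreflection_isRightHopfAnti :
    ∃ (R : BialgIn.{u, v} k ⥤ (isRightHopfAnti.{u, v} k).FullSubcategory)
      (adj : ObjectProperty.ιOfLE isRightHopfAnti_le_pInjective ⊣ R)
      (e : R ⋙ ObjectProperty.ιOfLE isRightHopfAnti_le_pInjective ≅ KinfIn.{u, v} k),
      adj.counit = e.hom ≫ sigmaInfIn k := by
  refine exists_rightAdjoint_counit_eq _ (sigmaInfIn k) inferInstance
    (fun B => ⟨((KinfIn k).obj B).obj,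
      exists_rightAntipode_of_bijective (pMap_KinfB_bijective B.property)⟩)
    (fun B => Iso.refl _) fun A B f => ?_
  obtain ⟨S, hS, hanti⟩ := A.property
  exact exists_lift_KinfIn (A := ⟨A.obj, _⟩) (hS.pMap_bijective hanti).2 f

end Categories

end

end KellyCofree

/-- The cofree-coalgebra sequence of `K` on bialgebras with injective `p` converges to
`K^∞ = ⋂ₙ Kⁿ`, and `K^∞` computes the cofree Hopf algebra of right perfect and of left `n`-Hopf
bialgebras. -/
theorem mainTheorem10 (k : Type u) [Field k] :
    -- `(K, k)` is a well-copointed endofunctor of `Bialg^in`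
    KellyCofree.IsWellCopointed (KellyCofree.Kin.{u, v} k) (KellyCofree.kappaIn.{u, v} k) ∧
    -- `K^∞(B)`, with `σ⁰_∞`, is the limit of the cofree-coalgebra sequence of `B`
    (∀ B : KellyCofree.BialgIn.{u, v} k,
      ∃ π : (Functor.const ℕᵒᵖ).obj ((KellyCofree.KinfIn k).obj B) ⟶
          KellyCofree.cofreeSeq (KellyCofree.Kin k) (KellyCofree.kappaIn k) B,
        π.app (Opposite.op 0) = (KellyCofree.sigmaInfIn k).app B ∧
        Nonempty (Limits.IsLimit (Limits.Cone.mk ((KellyCofree.KinfIn k).obj B) π))) ∧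
    -- `p` is bijective for `K^∞(B)`
    (∀ B : KellyCofree.BialgIn.{u, v} k,
      Function.Bijective (KellyCofree.pMap k (KellyCofree.KinfB k B.obj).toSubalgebra)) ∧
    -- `k K^∞ : K K^∞ ⟶ K^∞` is a natural isomorphism, i.e. the sequence converges at `∞`
    IsIso (Functor.whiskerLeft (KellyCofree.KinfIn.{u, v} k) (KellyCofree.kappaIn.{u, v} k)) ∧
    -- `K^∞(B)`, with `σ⁰_∞`, is the cofree `K`-coalgebra on `B`
    (∃ (R : KellyCofree.BialgIn.{u, v} k ⥤
          KellyCofree.CopointedCoalg (KellyCofree.Kin.{u, v} k) (KellyCofree.kappaIn.{u, v} k))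
        (adj : KellyCofree.CopointedCoalg.forget _ _ ⊣ R)
        (e : R ⋙ KellyCofree.CopointedCoalg.forget _ _ ≅ KellyCofree.KinfIn.{u, v} k),
        adj.counit = e.hom ≫ KellyCofree.sigmaInfIn k) ∧
    -- right Hopf algebras with anti-bialgebra right antipode are mono-coreflective in `Bialg^in`
    (∃ h : KellyCofree.isRightHopfAnti.{u, v} k ≤ KellyCofree.pInjective.{u, v} k,
      ∃ (R : KellyCofree.BialgIn.{u, v} k ⥤
          (KellyCofree.isRightHopfAnti.{u, v} k).FullSubcategory)
        (adj : ObjectProperty.ιOfLE h ⊣ R)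
        (e : R ⋙ ObjectProperty.ιOfLE h ≅ KellyCofree.KinfIn.{u, v} k),
        adj.counit = e.hom ≫ KellyCofree.sigmaInfIn k ∧ ∀ B, Mono (adj.counit.app B)) ∧
    -- `C(B) = K^∞(B)` for `B` right perfect
    (∀ (B : Type v) [Ring B] [Bialgebra k B], KellyCofree.IsRightPerfect B →
      KellyCofree.IsCofreeHopf.{u, v, w} (KellyCofree.KinfB k (BialgCat.of k B)).val) ∧
    -- `C(B) = K^∞(B)` for `B` a left `n`-Hopf algebra
    (∀ (B : Type v) [Ring B] [Bialgebra k B] (n : ℕ), KellyCofree.IsLeftNHopf k B n →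
      KellyCofree.IsCofreeHopf.{u, v, w} (KellyCofree.KinfB k (BialgCat.of k B)).val) := by
  refine ⟨KellyCofree.isWellCopointed_Kin, KellyCofree.exists_isLimit_cofreeSeq,
    fun B => KellyCofree.pMap_KinfB_bijective B.property, ?_,
    KellyCofree.exists_cofree_copointedCoalg,
    ⟨KellyCofree.isRightHopfAnti_le_pInjective, ?_⟩,
    fun B _ _ hB => (KellyCofree.IsRightPerfect.isLocallyLeftNHopf hB).isCofreeHopf,
    fun B _ _ n hB => ?_⟩
  · have (B : KellyCofree.BialgIn.{u, v} k) : IsIso ((Functor.whiskerLeft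
        (KellyCofree.KinfIn.{u, v} k) (KellyCofree.kappaIn.{u, v} k)).app B) :=
      KellyCofree.isIso_kappaIn_app (KellyCofree.pMap_KinfB_bijective B.property).2
    exact NatIso.isIso_of_isIso_app _
  · obtain ⟨R, adj, e, h⟩ := KellyCofree.exists_coreflection_isRightHopfAnti.{u, v} (k := k)
    refine ⟨R, adj, e, h, fun B => ?_⟩
    -- The counit is an isomorphism followed by the inclusion of `K^∞(B)`, hence monic.
    rw [h, NatTrans.comp_app]
    exact mono_comp _ _
  · obtain ⟨⟨S, hS⟩, -⟩ := hB
    exact hS.isLocallyLeftNHopf.isCofreeHopf
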